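/- **Programs.** A probabilistic program $P$ has a finite set $V$ of real-valued variables, a set of output variables $V_{out}\subseteq V$ and an initial valuation $\mathbf x_{in}\in\mathbb R^V$. Its code is built from $\mathbf{skip}$, assignments $x:=e$ ($e$ Borel), sampling $x:=\mathbf{sample}(d)$ ($d$ a probability distribution on $\mathbb R$), conditioning instructions $\mathbf{observe}(\varphi)$ ($\varphi$ a Borel predicate) and $\mathbf{score}(e)$ ($e\ge 0$ Borel), sequential composition, $\mathbf{if}$, $\mathbf{while}$, labels and $\mathbf{go\text{-}to}$ (no label is set twice, and every go-to has a target). A program without $\mathbf{observe}$ and $\mathbf{score}$ is *conditioning-free*. **Semantics.** $P$ induces a control-flow graph $\mathcal C(P)$ with one location per instruction and a terminal location $\ell_{out}$. It defines a Markov chain on states $(\ell,\mathbf x)$ (location, valuation) started in $(\ell_{in},\mathbf x_{in})$, in which each step executes one instruction and has a weight: $e(\mathbf x)$ for $\mathbf{score}(e)$, $\mathbb 1[\mathbf x\models\varphi]$ for $\mathbf{observe}(\varphi)$, and $1$ otherwise. A *run* is an infinite sequence of states, starting in the initial state, in which each state is a possible successor of the previous one (a sampled value is possible if it lies in the support of the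 distribution). A run is *terminating* if it reaches $\ell_{out}$; its *cumulative weight* $W(\rho)$ is then the product of the weights of its steps before it first reaches $\ell_{out}$, and its output is the valuation of $V_{out}$ at that time. With $\mathbb P,\mathbb E$ the law of the chain and its expectation, $P$ is *a.s. terminating* if $\mathbb P[\text{terminating}]=1$, *integrable* if $0<\mathbb E[W]<\infty$, and has the *bounded cumulative weight property* with bound $M>0$ if $W(\rho)\le M$ for every terminating run $\rho$. The *normalized output distribution* is $\mu^{\mathcal C(P)}[B]=\mathbb E[\mathbb 1_{\mathrm{Output}(B)}\,W]/\mathbb E[W]$ for Borel $B\subseteq\mathbb R^{V_{out}}$, where $\mathrm{Output}(B)$ is the set of terminating runs with output in $B$. **Weighted restarting.** For $M>0$, the program $P_{res}$ is obtained from $P$ by adding a fresh variable $W$ with initial value $1$; replacing each $\mathbf{observe}(\varphi)$ by "$\mathbf{if}\ \neg\varphi:\ W:=0$" and each $\mathbf{score}(e)$ by "$W:=W\cdot e$"; and appending at the end the block "$\mathbf{if\ prob}(1-W/M):\ \mathbf x:=\mathbf x_{in};\ W:=1;\ \mathbf{go\text{-}to}\ \ell_{in}$". Here $\mathbf{if\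 prob}(p)$ means: sample a fresh variable uniformly from $[0,1]$ and take the branch if its value is less than $p$. The output variables are unchanged. **Theorem (correctness of weighted restarting).** Let $P$ be a.s. terminating and integrable, and let it satisfy the bounded cumulative weight property with bound $M>0$. Then $P_{res}$ is conditioning-free, a.s. terminating, integrable, and satisfies the bounded cumulative weight property. Moreover $\mathcal C(P)$ and $\mathcal C(P_{res})$ are output equivalent: $\mu^{\mathcal C(P)}[B]=\mu^{\mathcal C(P_{res})}[B]$ for every Borel $B\subseteq\mathbb R^{V_{out}}$. -/

import Mathlib

open MeasureTheory ProbabilityTheory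
open scoped NNReal ENNReal

/-! ### Probabilistic control-flow graphs -/

/-- The update of one variable by a transition: no update, a Borel-measurable expression over the
variables, or a sample from a probability distribution. -/
inductive VarUpdate (V : Type) where
  | keep : VarUpdate V
  | expr (e : (V → ℝ) → ℝ) (he : Measurable e) : VarUpdate V
  | dist (δ : ProbabilityMeasure ℝ) : VarUpdate V

namespace VarUpdate

variable {V : Type}

/-- The law of the new value of the variable `v` under the update, from the valuation `x`. -/
noncomputable def law (u : VarUpdate V) (v : V) (x : V → ℝ) : Measure ℝ :=
  match u with
  | keep => Measure.dirac (x v)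
  | expr e _ => Measure.dirac (e x)
  | dist δ => (δ : Measure ℝ)

/-- The possible new values of the variable `v` under the update, from the valuation `x`. -/
def possible (u : VarUpdate V) (v : V) (x : V → ℝ) : Set ℝ :=
  match u with
  | keep => {x v}
  | expr e _ => {e x}
  | dist δ => (δ : Measure ℝ).support

instance (u : VarUpdate V) (v : V) (x : V → ℝ) : IsProbabilityMeasure (u.law v x) := by
  cases u <;> simp only [law] <;> infer_instance

theorem measurable_law (u : VarUpdate V) (v : V) : Measurable (u.law v) := by
  cases u with
  | keep => exact Measure.measurable_dirac.comp (measurable_pi_apply v)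
  | expr e he => exact Measure.measurable_dirac.comp he
  | dist δ => exact measurable_const

/-- The joint law of all variables after a simultaneous update; samples are independent. -/
noncomputable def jointLaw [Fintype V] (up : V → VarUpdate V) (x : V → ℝ) : Measure (V → ℝ) :=
  Measure.pi fun v => (up v).law v x

instance [Fintype V] (up : V → VarUpdate V) (x : V → ℝ) :
    IsProbabilityMeasure (jointLaw up x) := by
  unfold jointLaw; infer_instance

theorem measurable_jointLaw [Fintype V] (up : V → VarUpdate V) : Measurable (jointLaw up) := by
  refine Measurable.measure_of_isPiSystem_of_isProbabilityMeasure
    generateFrom_pi.symm isPiSystem_pi ?_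
  rintro _ ⟨s, hs, rfl⟩
  simp only [jointLaw, Measure.pi_pi]
  exact Finset.measurable_prod _ fun v _ =>
    (Measure.measurable_coe (show MeasurableSet (s v) from hs v (Set.mem_univ v))).comp
      ((up v).measurable_law v)

end VarUpdate

/-- A probabilistic control-flow graph with weights, over the program variables `V` and with
output variables `O`. Guards, updates and weights matter only on the transitions. At every state
exactly one transition is enabled. -/
structure PCFG (V O : Type) where
  Loc : Type
  finite_loc : Finite Loc
  out : O ↪ V
  locIn : Loc
  valIn : V → ℝ
  trans : Set (Loc × Loc)
  guard : Loc → Loc → Set (V → ℝ)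
  measurableSet_guard : ∀ l l', MeasurableSet (guard l l')
  up : Loc → Loc → V → VarUpdate V
  weight : Loc → Loc → (V → ℝ) → ℝ≥0
  measurable_weight : ∀ l l', Measurable (weight l l')
  locOut : Loc
  existsUnique_enabled : ∀ l x, ∃! l', (l, l') ∈ trans ∧ x ∈ guard l l'

namespace PCFG

variable {V O : Type} (C : PCFG V O)

instance : Finite C.Loc := C.finite_loc

instance : MeasurableSpace C.Loc := ⊤

instance : DiscreteMeasurableSpace C.Loc := ⟨fun _ => trivial⟩

/-- States: a location and a variable valuation. -/
abbrev State : Type := C.Loc × (V → ℝ)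

/-- The transition from `l` to `l'` is enabled at the state `(l, x)`. -/
def Enabled (l l' : C.Loc) (x : V → ℝ) : Prop := (l, l') ∈ C.trans ∧ x ∈ C.guard l l'

/-- `t` is a successor of `s`. -/
def Succ (s t : C.State) : Prop :=
  C.Enabled s.1 t.1 s.2 ∧ ∀ v, t.2 v ∈ (C.up s.1 t.1 v).possible v s.2

/-- Runs: infinite sequences of successive states that start in the initial state. -/
def Run : Set (ℕ → C.State) :=
  {ρ | ρ 0 = (C.locIn, C.valIn) ∧ ∀ n, C.Succ (ρ n) (ρ (n + 1))}

/-- Terminating runs. -/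
def Term : Set (ℕ → C.State) := {ρ | ρ ∈ C.Run ∧ ∃ n, (ρ n).1 = C.locOut}

/-- The termination time of a terminating run (not used on other sequences). -/
noncomputable def termTime (ρ : ℕ → C.State) : ℕ := sInf {n | (ρ n).1 = C.locOut}

/-- The cumulative weight of a terminating run. -/
noncomputable def cumWeight (ρ : ℕ → C.State) : ℝ≥0 :=
  ∏ i ∈ Finset.range (C.termTime ρ), C.weight (ρ i).1 (ρ (i + 1)).1 (ρ i).2

/-- The cumulative weight of every terminating run is at most `M`. -/
def WeightBoundedBy (M : ℝ) : Prop := ∀ ρ ∈ C.Term, (C.cumWeight ρ : ℝ) ≤ M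

/-- The bounded cumulative weight property. -/
def WeightBounded : Prop := ∃ M : ℝ, 0 < M ∧ C.WeightBoundedBy M

/-- The terminating runs whose output lies in `B`. -/
def Output (B : Set (O → ℝ)) : Set (ℕ → C.State) :=
  {ρ | ρ ∈ C.Term ∧ (fun o => (ρ (C.termTime ρ)).2 (C.out o)) ∈ B}

/-- The target of the unique transition enabled at a state. -/
noncomputable def nextLoc (s : C.State) : C.Loc := (C.existsUnique_enabled s.1 s.2).choose

theorem nextLoc_eq_iff (s : C.State) (l' : C.Loc) :
    C.nextLoc s = l' ↔ C.Enabled s.1 l' s.2 := by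
  have h := (C.existsUnique_enabled s.1 s.2).choose_spec
  exact ⟨fun e => e ▸ h.1, fun e => (h.2 l' e).symm⟩

theorem measurable_nextLoc : Measurable C.nextLoc := by
  refine measurable_from_prod_countable_right fun l => measurable_to_countable' fun l' => ?_
  have : (fun x => C.nextLoc (l, x)) ⁻¹' {l'} = {x | (l, l') ∈ C.trans} ∩ C.guard l l' := by
    ext x
    simpa [Enabled] using C.nextLoc_eq_iff (l, x) l'
  rw [this]
  exact (MeasurableSet.const _).inter (C.measurableSet_guard l l')

variable [Fintype V]

/-- The law of the next state. -/
noncomputable def stepLaw (s : C.State) : Measure C.State :=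
  (VarUpdate.jointLaw (C.up s.1 (C.nextLoc s)) s.2).map fun y => (C.nextLoc s, y)

theorem measurable_stepLaw : Measurable C.stepLaw := by
  have h : Measurable fun p : (C.Loc × C.Loc) × (V → ℝ) =>
      (VarUpdate.jointLaw (C.up p.1.1 p.1.2) p.2).map fun y => (p.1.2, y) :=
    measurable_from_prod_countable_right fun p =>
      (Measure.measurable_map (fun y : V → ℝ => (p.2, y)) measurable_prodMk_left).comp
        (VarUpdate.measurable_jointLaw (C.up p.1 p.2))
  exact h.comp ((measurable_fst.prodMk C.measurable_nextLoc).prodMk measurable_snd)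

/-- The transition kernel of the Markov process. -/
noncomputable def stepKernel : Kernel C.State C.State := ⟨C.stepLaw, C.measurable_stepLaw⟩

instance : IsMarkovKernel C.stepKernel :=
  ⟨fun s => Measure.isProbabilityMeasure_map (f := fun y => (C.nextLoc s, y))
    measurable_prodMk_left.aemeasurable⟩

/-- The law of the Markov process started in the initial state, on sequences of states. -/
noncomputable def runMeasure : Measure (ℕ → C.State) :=
  Kernel.trajMeasure (X := fun _ => C.State) (Measure.dirac (C.locIn, C.valIn)) fun n =>
    C.stepKernel.comap (fun h : (i : Finset.Iic n) → C.State => h ⟨n, Finset.mem_Iic.2 le_rfl⟩)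
      (measurable_pi_apply _)

/-- Almost-sure termination. -/
def ASTerminating : Prop := C.runMeasure C.Term = 1

/-- The expected cumulative weight. -/
noncomputable def expWeight : ℝ≥0∞ := ∫⁻ ρ in C.Term, (C.cumWeight ρ : ℝ≥0∞) ∂C.runMeasure

/-- The expected cumulative weight is positive and finite. -/
def WeightIntegrable : Prop := 0 < C.expWeight ∧ C.expWeight < ∞


/-- The normalized output distribution, as a function of Borel sets. -/
noncomputable def nod (B : Set (O → ℝ)) : ℝ≥0∞ :=
  (∫⁻ ρ in C.Output B, (C.cumWeight ρ : ℝ≥0∞) ∂C.runMeasure) / C.expWeight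

/-- Two graphs with the same output variables have the same normalized output distribution. -/
def OutputEquivalent {V₁ V₂ : Type} [Fintype V₁] [Fintype V₂] (C₁ : PCFG V₁ O)
    (C₂ : PCFG V₂ O) : Prop :=
  ∀ B : Set (O → ℝ), MeasurableSet B → C₁.nod B = C₂.nod B

end PCFG

/-! ### Programs -/

/-- Statements of imperative probabilistic programs, with variables `V` and labels `Λ`. -/
inductive Stmt (V Λ : Type) where
  | skip : Stmt V Λ
  | assign (v : V) (e : (V → ℝ) → ℝ) (he : Measurable e) : Stmt V Λ
  | sample (v : V) (d : ProbabilityMeasure ℝ) : Stmt V Λ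
  | observe (φ : Set (V → ℝ)) (hφ : MeasurableSet φ) : Stmt V Λ
  | score (e : (V → ℝ) → ℝ≥0) (he : Measurable e) : Stmt V Λ
  | seq (s t : Stmt V Λ) : Stmt V Λ
  | ite (φ : Set (V → ℝ)) (hφ : MeasurableSet φ) (s t : Stmt V Λ) : Stmt V Λ
  | while (φ : Set (V → ℝ)) (hφ : MeasurableSet φ) (s : Stmt V Λ) : Stmt V Λ
  | label (a : Λ) (s : Stmt V Λ) : Stmt V Λ
  | goto (a : Λ) : Stmt V Λ

/-- The instruction at a location: an update of the variables with a weight and one next location,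
or a branching on a predicate. -/
inductive Node (V L : Type) where
  | step (up : V → VarUpdate V) (w : (V → ℝ) → ℝ≥0) (hw : Measurable w) (next : L) : Node V L
  | branch (φ : Set (V → ℝ)) (hφ : MeasurableSet φ) (yes no : L) : Node V L

namespace Node

variable {V L : Type}

/-- The targets of the transitions out of the location. -/
def targets : Node V L → Set L
  | step _ _ _ n => {n}
  | branch _ _ y n => {y, n}

open Classical in
/-- The next location from a valuation. -/
noncomputable def dest : Node V L → (V → ℝ) → L
  | step _ _ _ n, _ => n
  | branch φ _ y n, x => if x ∈ φ then y else n

/-- The updates of the transitions out of the location. -/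
def up : Node V L → V → VarUpdate V
  | step u _ _ _ => u
  | branch _ _ _ _ => fun _ => VarUpdate.keep

/-- The weight of the transitions out of the location. -/
def weight : Node V L → (V → ℝ) → ℝ≥0
  | step _ w _ _ => w
  | branch _ _ _ _ => fun _ => 1

theorem dest_mem_targets (N : Node V L) (x : V → ℝ) : N.dest x ∈ N.targets := by
  cases N with
  | step => simp [dest, targets]
  | branch φ _ y n => by_cases h : x ∈ φ <;> simp [dest, targets, h]

theorem measurable_weight (N : Node V L) : Measurable N.weight := by
  cases N with
  | step _ _ hw _ => exact hw
  | branch => exact measurable_const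

theorem measurableSet_dest (N : Node V L) (l : L) : MeasurableSet {x | N.dest x = l} := by
  classical
  cases N with
  | step _ _ _ n => exact MeasurableSet.const (n = l)
  | branch φ hφ y n =>
    have : {x | (branch φ hφ y n).dest x = l} =
        (φ ∩ {_x | y = l}) ∪ (φᶜ ∩ {_x | n = l}) := by
      ext x
      by_cases h : x ∈ φ <;> simp [dest, h]
    rw [this]
    exact (hφ.inter (MeasurableSet.const _)).union (hφ.compl.inter (MeasurableSet.const _))

/-- A step that changes no variable and has weight one. -/
def jump (next : L) : Node V L :=
  step (fun _ => VarUpdate.keep) (fun _ => 1) measurable_const next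

open Classical in
/-- A step that updates the single variable `v` and has weight one. -/
noncomputable def set (v : V) (u : VarUpdate V) (next : L) : Node V L :=
  step (fun v' => if v' = v then u else VarUpdate.keep) (fun _ => 1) measurable_const next

open Classical in
/-- A step that changes no variable and has weight one on `φ`, zero outside. -/
noncomputable def check (φ : Set (V → ℝ)) (hφ : MeasurableSet φ) (next : L) : Node V L :=
  step (fun _ => VarUpdate.keep) (fun x => if x ∈ φ then 1 else 0)
    (Measurable.ite hφ measurable_const measurable_const) next

/-- A step that changes no variable and has weight `e`. -/
def weigh (e : (V → ℝ) → ℝ≥0) (he : Measurable e) (next : L) : Node V L :=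
  step (fun _ => VarUpdate.keep) e he next

end Node

namespace Stmt

variable {V Λ : Type}

/-- The locations inside a statement: one for each instruction. -/
def Loc : Stmt V Λ → Type
  | skip => Unit
  | assign _ _ _ => Unit
  | sample _ _ => Unit
  | observe _ _ => Unit
  | score _ _ => Unit
  | seq s t => s.Loc ⊕ t.Loc
  | ite _ _ s t => Option (s.Loc ⊕ t.Loc)
  | .while _ _ s => Option s.Loc
  | label _ s => s.Loc
  | goto _ => Unit

theorem finite_loc : ∀ s : Stmt V Λ, Finite s.Loc
  | skip | assign _ _ _ | sample _ _ | observe _ _ | score _ _ | goto _ =>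
    inferInstanceAs (Finite Unit)
  | seq s t =>
    have := s.finite_loc
    have := t.finite_loc
    inferInstanceAs (Finite (s.Loc ⊕ t.Loc))
  | ite _ _ s t =>
    have := s.finite_loc
    have := t.finite_loc
    inferInstanceAs (Finite (Option (s.Loc ⊕ t.Loc)))
  | .while _ _ s =>
    have := s.finite_loc
    inferInstanceAs (Finite (Option s.Loc))
  | label _ s => s.finite_loc

/-- The location at which the execution of a statement starts. -/
def entry : (s : Stmt V Λ) → s.Loc
  | skip => ()
  | assign _ _ _ => ()
  | sample _ _ => ()
  | observe _ _ => ()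
  | score _ _ => ()
  | seq s _ => Sum.inl s.entry
  | ite _ _ _ _ => none
  | .while _ _ _ => none
  | label _ s => s.entry
  | goto _ => ()

/-- The labels set in a statement, with multiplicity. -/
def labels : Stmt V Λ → List Λ
  | seq s t => s.labels ++ t.labels
  | ite _ _ s t => s.labels ++ t.labels
  | .while _ _ s => s.labels
  | label a s => a :: s.labels
  | _ => []

/-- The labels that are the target of some go-to in a statement. -/
def gotos : Stmt V Λ → List Λ
  | seq s t => s.gotos ++ t.gotos
  | ite _ _ s t => s.gotos ++ t.gotos
  | .while _ _ s => s.gotos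
  | label _ s => s.gotos
  | goto a => [a]
  | _ => []

/-- The location that carries a label, if there is one. -/
def find [DecidableEq Λ] : (s : Stmt V Λ) → Λ → Option s.Loc
  | skip, _ => none
  | assign _ _ _, _ => none
  | sample _ _, _ => none
  | observe _ _, _ => none
  | score _ _, _ => none
  | seq s t, b => ((s.find b).map Sum.inl).or ((t.find b).map Sum.inr)
  | ite _ _ s t, b =>
    ((s.find b).map fun l => some (Sum.inl l)).or ((t.find b).map fun l => some (Sum.inr l))
  | .while _ _ s, b => (s.find b).map some
  | label a s, b => if a = b then some s.entry else s.find b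
  | goto _, _ => none

/-- The instruction at each location of a statement placed into a larger graph with locations `L`:
`emb` embeds the locations of the statement, `next` is the location that follows the statement,
and `tgt` gives the location of each label. -/
noncomputable def node {L : Type} (tgt : Λ → L) :
    (s : Stmt V Λ) → (emb : s.Loc → L) → (next : L) → s.Loc → Node V L
  | skip, _, next, _ => Node.jump next
  | assign v e he, _, next, _ => Node.set v (VarUpdate.expr e he) next
  | sample v d, _, next, _ => Node.set v (VarUpdate.dist d) next
  | observe φ hφ, _, next, _ => Node.check φ hφ next
  | score e he, _, next, _ => Node.weigh e he next
  | seq s t, emb, next, l =>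
    match l with
    | Sum.inl l => s.node tgt (fun k => emb (Sum.inl k)) (emb (Sum.inr t.entry)) l
    | Sum.inr l => t.node tgt (fun k => emb (Sum.inr k)) next l
  | ite φ hφ s t, emb, next, l =>
    match l with
    | none => Node.branch φ hφ (emb (some (Sum.inl s.entry))) (emb (some (Sum.inr t.entry)))
    | some (Sum.inl l) => s.node tgt (fun k => emb (some (Sum.inl k))) next l
    | some (Sum.inr l) => t.node tgt (fun k => emb (some (Sum.inr k))) next l
  | .while φ hφ s, emb, next, l =>
    match l with
    | none => Node.branch φ hφ (emb (some s.entry)) next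
    | some l => s.node tgt (fun k => emb (some k)) (emb none) l
  | label _ s, emb, next, l => s.node tgt emb next l
  | goto a, _, _, _ => Node.jump (tgt a)

/-- The statement contains neither `observe` nor `score`. -/
def ConditioningFree : Stmt V Λ → Prop
  | observe _ _ => False
  | score _ _ => False
  | seq s t => s.ConditioningFree ∧ t.ConditioningFree
  | ite _ _ s t => s.ConditioningFree ∧ t.ConditioningFree
  | .while _ _ s => s.ConditioningFree
  | label _ s => s.ConditioningFree
  | _ => True

end Stmt

/-- A probabilistic program with variables `V`, output variables `O` and labels `Λ`: its code and
the initial valuation. No label is set twice, and every go-to has a target. -/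
structure Program (V O Λ : Type) where
  body : Stmt V Λ
  valIn : V → ℝ
  out : O ↪ V
  nodup_labels : body.labels.Nodup
  gotos_subset : ∀ a ∈ body.gotos, a ∈ body.labels

namespace Program

variable {V O Λ : Type}

/-- The instruction at each location of a program. The location `none` is the terminal one, which
has a self-loop only; `some l` is the location `l` of the code. -/
noncomputable def node [DecidableEq Λ] (P : Program V O Λ) :
    Option P.body.Loc → Node V (Option P.body.Loc)
  | none => Node.jump none
  | some l => P.body.node (fun a => P.body.find a) some none l

/-- The control-flow graph of a program. -/
noncomputable def pcfg [DecidableEq Λ] (P : Program V O Λ) : PCFG V O where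
  Loc := Option P.body.Loc
  finite_loc := have := P.body.finite_loc; inferInstance
  out := P.out
  locIn := some P.body.entry
  valIn := P.valIn
  trans := {τ | τ.2 ∈ (P.node τ.1).targets}
  guard l l' := {x | (P.node l).dest x = l'}
  measurableSet_guard l l' := (P.node l).measurableSet_dest l'
  up l _ := (P.node l).up
  weight l _ := (P.node l).weight
  measurable_weight l _ := (P.node l).measurable_weight
  locOut := none
  existsUnique_enabled l x :=
    ⟨(P.node l).dest x, ⟨(P.node l).dest_mem_targets x, rfl⟩, fun _ h => h.2.symm⟩

/-- The program contains neither `observe` nor `score`. -/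
def ConditioningFree (P : Program V O Λ) : Prop := P.body.ConditioningFree

end Program

/-! ### Weighted restarting -/

/-- The program variables together with two fresh ones. -/
abbrev ResVar (V : Type) : Type := V ⊕ Fin 2

namespace ResVar

variable {V : Type}

/-- The weight variable `W`. -/
abbrev weight : ResVar V := Sum.inr 0

/-- The variable that holds the random number for the probabilistic branching. -/
abbrev coin : ResVar V := Sum.inr 1

/-- The valuation of the original variables. -/
def old (x : ResVar V → ℝ) : V → ℝ := fun v => x (Sum.inl v)

theorem measurable_old : Measurable (old (V := V)) :=
  measurable_pi_lambda _ fun v => measurable_pi_apply (Sum.inl v)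

end ResVar

/-- The uniform distribution on `[0, 1]`. -/
noncomputable def uniformUnit : ProbabilityMeasure ℝ :=
  ⟨volume.restrict (Set.Icc 0 1), ⟨by simp⟩⟩

namespace Stmt

variable {V Λ : Type}

/-- Replace `observe φ` by `if ¬φ: W := 0` and `score e` by `W := W * e`. The new label `none` is
kept for the initial location. -/
def trackWeight : Stmt V Λ → Stmt (ResVar V) (Option Λ)
  | skip => skip
  | assign v e he => assign (Sum.inl v) (fun x => e (ResVar.old x)) (he.comp ResVar.measurable_old)
  | sample v d => sample (Sum.inl v) d
  | observe φ hφ =>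
    ite (ResVar.old ⁻¹' φ)ᶜ (ResVar.measurable_old hφ).compl
      (assign ResVar.weight (fun _ => 0) measurable_const) skip
  | score e he =>
    assign ResVar.weight (fun x => x ResVar.weight * (e (ResVar.old x) : ℝ))
      ((measurable_pi_apply _).mul (he.comp ResVar.measurable_old).coe_nnreal_real)
  | seq s t => seq s.trackWeight t.trackWeight
  | ite φ hφ s t =>
    ite (ResVar.old ⁻¹' φ) (ResVar.measurable_old hφ) s.trackWeight t.trackWeight
  | .while φ hφ s => .while (ResVar.old ⁻¹' φ) (ResVar.measurable_old hφ) s.trackWeight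
  | label a s => label (some a) s.trackWeight
  | goto a => goto (some a)

/-- The code `v₁ := x v₁; …; vₖ := x vₖ` for the variables of a list. -/
def resetVars (x : V → ℝ) : List V → Stmt (ResVar V) (Option Λ)
  | [] => skip
  | v :: vs => seq (assign (Sum.inl v) (fun _ => x v) measurable_const) (resetVars x vs)

/-- The code `if prob(p): s`, by a uniform sample and a comparison. -/
noncomputable def ifProb (p : (ResVar V → ℝ) → ℝ) (hp : Measurable p)
    (s : Stmt (ResVar V) (Option Λ)) : Stmt (ResVar V) (Option Λ) :=
  seq (sample ResVar.coin uniformUnit)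
    (ite {x | x ResVar.coin < p x} (measurableSet_lt (measurable_pi_apply _) hp) s skip)

/-- The code `if prob(1 - W/M): x := xIn; W := 1; go-to` the initial location. -/
noncomputable def restartBlock [Fintype V] (M : ℝ) (xIn : V → ℝ) :
    Stmt (ResVar V) (Option Λ) :=
  ifProb (fun x => 1 - x ResVar.weight / M)
    (by fun_prop)
    (seq (resetVars xIn Finset.univ.toList)
      (seq (assign ResVar.weight (fun _ => 1) measurable_const) (goto none)))

theorem labels_trackWeight (s : Stmt V Λ) : s.trackWeight.labels = s.labels.map some := by
  induction s <;> simp_all [trackWeight, labels]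

theorem gotos_trackWeight (s : Stmt V Λ) : s.trackWeight.gotos = s.gotos.map some := by
  induction s <;> simp_all [trackWeight, gotos]

theorem labels_resetVars (x : V → ℝ) (vs : List V) :
    (resetVars (Λ := Λ) x vs).labels = [] := by
  induction vs <;> simp_all [resetVars, labels]

theorem gotos_resetVars (x : V → ℝ) (vs : List V) :
    (resetVars (Λ := Λ) x vs).gotos = [] := by
  induction vs <;> simp_all [resetVars, gotos]

theorem labels_restartBlock [Fintype V] (M : ℝ) (xIn : V → ℝ) :
    (restartBlock (Λ := Λ) M xIn).labels = [] := by
  simp [restartBlock, ifProb, labels, labels_resetVars]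

theorem gotos_restartBlock [Fintype V] (M : ℝ) (xIn : V → ℝ) :
    (restartBlock (Λ := Λ) M xIn).gotos = [none] := by
  simp [restartBlock, ifProb, gotos, gotos_resetVars]

end Stmt

/-- Weighted restarting of a program with the bound `M`. -/
noncomputable def Program.restart {V O Λ : Type} [Fintype V] (P : Program V O Λ) (M : ℝ) :
    Program (ResVar V) O (Option Λ) where
  body := Stmt.seq (Stmt.label none P.body.trackWeight) (Stmt.restartBlock M P.valIn)
  valIn := Sum.elim P.valIn ![1, 0]
  out := P.out.trans Function.Embedding.inl
  nodup_labels := by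
    simpa [Stmt.labels, Stmt.labels_trackWeight, Stmt.labels_restartBlock] using
      P.nodup_labels.map (Option.some_injective Λ)
  gotos_subset := by
    have h := P.gotos_subset
    intro a ha
    cases a <;> simp_all [Stmt.labels, Stmt.gotos, Stmt.labels_trackWeight,
      Stmt.gotos_trackWeight, Stmt.labels_restartBlock, Stmt.gotos_restartBlock]

/-!
The restarted program proceeds in rounds. A round simulates one run of the original program `P`
while the variable `W` accumulates its weight, and then accepts with probability `W / M`, or else
starts again from the initial valuation. Let `a` be the expected cumulative weight of `P`, let `b`
be the part of it carried by the runs with output in `B`, and let `p` be the probability that the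
restarted program outputs a value in `B`. Since `P` terminates almost surely and `W ≤ M`,
`p = b / M + (1 - a / M) * p`. Since `p ≤ 1` and `0 < a < ∞`, this forces `p = b / a`, which is the
normalized output distribution of `P` at `B`. For `B = univ` it says that the restarted program
terminates almost surely; as all its weights are one, the remaining claims follow.

To avoid decomposing sequences of states into rounds, `p` is studied as a function of the state.
`PCFG.hit` is the supremum of iterated one-step expectations; it satisfies the one-step equation
(`PCFG.hit_of_ne`) and agrees with the probability on sequences of states (`PCFG.hit_init`).
`Stmt.eq_expect_of_trackWeight`, by induction on statements, transports the one-step equation from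
the instrumented code to `P`: the hitting probability of the restarted program, as a function of a
state of `P` and an accumulated weight, is preserved by the steps of `P`. Optional stopping at the
termination time of `P` (`PCFG.lintegral_termTime`), together with the evaluation of the restart
block (`Stmt.eq_of_restartBlock`), gives the equation for `p`
(`Program.restart_runMeasure_reachOutput`). Almost every sequence of states is a run
(`PCFG.ae_mem_run`), so that terminating runs may be replaced by the measurable set of sequences
that reach the terminal location.
-/

/-! ### Homogeneous Markov chains -/

section Chain

variable {S : Type*} [MeasurableSpace S] (κ : Kernel S S) [IsMarkovKernel κ] (s₀ : S)

/-- The law, on sequences, of the Markov chain with transition kernel `κ` started at `s₀`. -/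
noncomputable def chainMeasure : Measure (ℕ → S) :=
  Kernel.trajMeasure (X := fun _ => S) (Measure.dirac s₀) fun n =>
    κ.comap (fun h : (i : Finset.Iic n) → S => h ⟨n, Finset.mem_Iic.2 le_rfl⟩)
      (measurable_pi_apply _)

instance : IsProbabilityMeasure (chainMeasure κ s₀) := by
  unfold chainMeasure; infer_instance

theorem ae_chainMeasure_zero [MeasurableSingletonClass S] :
    ∀ᵐ ρ ∂chainMeasure κ s₀, ρ 0 = s₀ := by
  have h : (chainMeasure κ s₀).map (Preorder.frestrictLe (π := fun _ => S) 0) =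
      (Measure.dirac s₀).map (MeasurableEquiv.piUnique (fun _ : Finset.Iic 0 => S)).symm := by
    rw [chainMeasure, Kernel.trajMeasure, Measure.map_comp _ _ (by fun_prop),
      Kernel.traj_map_frestrictLe, Kernel.partialTraj_self, Measure.id_comp]
  have h' : ∀ᵐ x ∂(chainMeasure κ s₀).map (Preorder.frestrictLe (π := fun _ => S) 0),
      x ⟨0, Finset.mem_Iic.2 le_rfl⟩ = s₀ := by
    have hm : MeasurableSet {x : (i : Finset.Iic 0) → S | x ⟨0, Finset.mem_Iic.2 le_rfl⟩ = s₀} :=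
      measurable_pi_apply (X := fun _ => S) _ (measurableSet_singleton s₀)
    rw [h]
    refine (ae_map_iff (MeasurableEquiv.measurable _).aemeasurable hm).2 ?_
    exact (ae_dirac_iff (MeasurableEquiv.measurable _ hm)).2 rfl
  exact ae_of_ae_map (by fun_prop) h'

/-- The Markov property: given a quantity `g` that depends only on the first `n + 1` states, the
next state is distributed according to the transition kernel at the current state. -/
theorem lintegral_chainMeasure_succ {α : Type*} [MeasurableSpace α] (n : ℕ) {g : (ℕ → S) → α}
    (hg : Measurable g) (hgn : ∀ ρ, g (fun i => ρ (min i n)) = g ρ) {f : α × S → ℝ≥0∞}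
    (hf : Measurable f) :
    ∫⁻ ρ, f (g ρ, ρ (n + 1)) ∂chainMeasure κ s₀ =
      ∫⁻ ρ, ∫⁻ t, f (g ρ, t) ∂κ (ρ n) ∂chainMeasure κ s₀ := by
  set η : (n : ℕ) → Kernel ((i : Finset.Iic n) → S) S := fun n =>
    κ.comap (fun h : (i : Finset.Iic n) → S => h ⟨n, Finset.mem_Iic.2 le_rfl⟩)
      (measurable_pi_apply _)
  have key := Kernel.map_frestrictLe_trajMeasure_compProd_eq_map_trajMeasure
    (X := fun _ => S) (κ := η) (μ₀ := Measure.dirac s₀) (a := n)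
  change (chainMeasure κ s₀).map _ ⊗ₘ η n = (chainMeasure κ s₀).map _ at key
  -- Histories are extended by their last entry, so that `g` applies to them.
  let e : ((i : Finset.Iic n) → S) → ℕ → S := fun h i =>
    h ⟨min i n, Finset.mem_Iic.2 (min_le_right _ _)⟩
  have he : Measurable e := measurable_pi_lambda _ fun i => measurable_pi_apply _
  have hge : ∀ ρ : ℕ → S, g (e (Preorder.frestrictLe (π := fun _ => S) n ρ)) = g ρ :=
    fun ρ => hgn ρ
  have hF : Measurable fun p : ((i : Finset.Iic n) → S) × S => f (g (e p.1), p.2) := by fun_prop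
  have h1 := lintegral_map (μ := chainMeasure κ s₀)
    (g := fun ρ => (Preorder.frestrictLe (π := fun _ => S) n ρ, ρ (n + 1))) hF (by fun_prop)
  rw [← key, Measure.lintegral_compProd hF, lintegral_map hF.lintegral_kernel_prod_right'
    (by fun_prop)] at h1
  simp only [hge] at h1
  rw [← h1]
  rfl

/-- A relation that holds almost surely between a state and its successor holds almost surely
along the chain. -/
theorem ae_chainMeasure_succ {R : Set (S × S)} (hR : MeasurableSet R)
    (h : ∀ s, ∀ᵐ t ∂κ s, (s, t) ∈ R) : ∀ᵐ ρ ∂chainMeasure κ s₀, ∀ n, (ρ n, ρ (n + 1)) ∈ R := by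
  refine ae_all_iff.2 fun n => ?_
  have key := lintegral_chainMeasure_succ κ s₀ n (g := fun ρ => ρ n) (by fun_prop) (by simp)
    (f := Rᶜ.indicator 1) (measurable_one.indicator hR.compl)
  have h0 : ∀ s, ∫⁻ t, Rᶜ.indicator 1 (s, t) ∂κ s = 0 := fun s => by
    rw [lintegral_congr_ae (g := 0), lintegral_zero_fun]
    filter_upwards [h s] with t ht
    simp [ht]
  simp only [h0, lintegral_zero] at key
  have hm : Measurable fun ρ : ℕ → S => Rᶜ.indicator (1 : S × S → ℝ≥0∞) (ρ n, ρ (n + 1)) :=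
    (measurable_one.indicator hR.compl).comp (by fun_prop)
  filter_upwards [(lintegral_eq_zero_iff hm).1 key] with ρ hρ
  by_contra hc
  simp [hc] at hρ

end Chain

/-! ### Almost sure properties of runs -/

namespace VarUpdate

variable {V : Type}

theorem ae_mem_possible (u : VarUpdate V) (v : V) (x : V → ℝ) :
    ∀ᵐ r ∂u.law v x, r ∈ u.possible v x := by
  cases u with
  | keep => exact (ae_dirac_iff (measurableSet_singleton _)).2 rfl
  | expr e he => exact (ae_dirac_iff (measurableSet_singleton _)).2 rfl
  | dist δ => exact Measure.support_mem_ae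

theorem measurableSet_possible (u : VarUpdate V) (v : V) :
    MeasurableSet {p : (V → ℝ) × ℝ | p.2 ∈ u.possible v p.1} := by
  cases u with
  | keep =>
    exact measurableSet_eq_fun measurable_snd ((measurable_pi_apply v).comp measurable_fst)
  | expr e he => exact measurableSet_eq_fun measurable_snd (he.comp measurable_fst)
  | dist δ => exact measurable_snd Measure.isClosed_support.measurableSet

end VarUpdate

namespace PCFG

variable {V O : Type} (C : PCFG V O)

/-- The sequences of states that reach the terminal location. Up to a null set these are the
terminating runs. -/
def Reach : Set (ℕ → C.State) := {ρ | ∃ n, (ρ n).1 = C.locOut}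

theorem measurableSet_fst_eq (n : ℕ) (l : C.Loc) :
    MeasurableSet {ρ : ℕ → C.State | (ρ n).1 = l} :=
  (measurable_fst.comp (measurable_pi_apply n)) (measurableSet_singleton l)

theorem measurableSet_reach : MeasurableSet C.Reach := by
  have : C.Reach = ⋃ n, {ρ : ℕ → C.State | (ρ n).1 = C.locOut} := by ext; simp [Reach]
  rw [this]
  exact MeasurableSet.iUnion fun n => C.measurableSet_fst_eq n _

variable {C} in
theorem fst_termTime {ρ : ℕ → C.State} (h : ρ ∈ C.Reach) : (ρ (C.termTime ρ)).1 = C.locOut :=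
  Nat.sInf_mem (s := {n | (ρ n).1 = C.locOut}) h

variable {C} in
theorem fst_ne_of_lt_termTime {ρ : ℕ → C.State} {m : ℕ} (h : m < C.termTime ρ) :
    (ρ m).1 ≠ C.locOut :=
  Nat.notMem_of_lt_sInf (s := {n | (ρ n).1 = C.locOut}) h

theorem measurable_termTime : Measurable C.termTime := by
  classical
  have hex : ∀ ρ : ℕ → C.State, ∃ n, (ρ n).1 = C.locOut ∨ ρ ∉ C.Reach := fun ρ => by
    by_cases h : ρ ∈ C.Reach
    · exact h.imp fun _ => Or.inl
    · exact ⟨0, Or.inr h⟩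
  have heq : C.termTime = fun ρ => Nat.find (hex ρ) := by
    funext ρ
    symm
    rw [Nat.find_eq_iff]
    by_cases h : ρ ∈ C.Reach
    · exact ⟨Or.inl (fst_termTime h), fun m hm hc =>
        hc.elim (fst_ne_of_lt_termTime hm) fun hc => hc h⟩
    · have h0 : C.termTime ρ = 0 := by
        have : {n | (ρ n).1 = C.locOut} = ∅ := by
          ext n; simpa using fun hn => h ⟨n, hn⟩
        rw [termTime, this, Nat.sInf_empty]
      exact ⟨Or.inr h, by simp [h0]⟩
  rw [heq]
  exact measurable_find hex fun n =>
    (C.measurableSet_fst_eq n _).union C.measurableSet_reach.compl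

theorem measurable_state_termTime :
    Measurable fun ρ : ℕ → C.State => ρ (C.termTime ρ) := by
  have h : Measurable fun p : ℕ × (ℕ → C.State) => p.2 p.1 :=
    measurable_from_prod_countable_right fun n => measurable_pi_apply n
  exact h.comp (C.measurable_termTime.prodMk measurable_id)

theorem measurable_stepWeight :
    Measurable fun p : C.State × C.State => C.weight p.1.1 p.2.1 p.1.2 := by
  have h : Measurable fun p : (C.Loc × C.Loc) × (V → ℝ) => C.weight p.1.1 p.1.2 p.2 :=
    measurable_from_prod_countable_right fun p => C.measurable_weight p.1 p.2
  exact h.comp (f := fun p : C.State × C.State => ((p.1.1, p.2.1), p.1.2)) (by fun_prop)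

theorem measurable_cumWeight : Measurable C.cumWeight := by
  have h : Measurable fun p : ℕ × (ℕ → C.State) =>
      ∏ i ∈ Finset.range p.1, C.weight (p.2 i).1 (p.2 (i + 1)).1 (p.2 i).2 :=
    measurable_from_prod_countable_right fun n =>
      Finset.measurable_prod (Finset.range n) fun i _ => C.measurable_stepWeight.comp
        (f := fun ρ : ℕ → C.State => (ρ i, ρ (i + 1))) (by fun_prop)
  exact h.comp (C.measurable_termTime.prodMk measurable_id)

/-- The sequences of states that reach the terminal location with an output in `B`. -/
def ReachOutput (B : Set (O → ℝ)) : Set (ℕ → C.State) :=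
  C.Reach ∩ {ρ | (fun o => (ρ (C.termTime ρ)).2 (C.out o)) ∈ B}

theorem measurableSet_reachOutput {B : Set (O → ℝ)} (hB : MeasurableSet B) :
    MeasurableSet (C.ReachOutput B) := by
  refine C.measurableSet_reach.inter (measurableSet_preimage ?_ hB)
  exact measurable_pi_lambda _ fun o =>
    (measurable_pi_apply _).comp (measurable_snd.comp C.measurable_state_termTime)

variable [Fintype V]

theorem runMeasure_eq : C.runMeasure = chainMeasure C.stepKernel (C.locIn, C.valIn) := rfl

instance : IsProbabilityMeasure C.runMeasure := by
  rw [runMeasure_eq]; infer_instance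

theorem lintegral_stepKernel (s : C.State) {f : C.State → ℝ≥0∞} (hf : Measurable f) :
    ∫⁻ t, f t ∂C.stepKernel s =
      ∫⁻ y, f (C.nextLoc s, y) ∂VarUpdate.jointLaw (C.up s.1 (C.nextLoc s)) s.2 :=
  lintegral_map hf measurable_prodMk_left

theorem measurableSet_succ : MeasurableSet {p : C.State × C.State | C.Succ p.1 p.2} := by
  have h1 : MeasurableSet {p : C.State × C.State | C.Enabled p.1.1 p.2.1 p.1.2} := by
    have : {p : C.State × C.State | C.Enabled p.1.1 p.2.1 p.1.2} =
        {p | C.nextLoc p.1 = p.2.1} := by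
      ext p; exact (C.nextLoc_eq_iff p.1 p.2.1).symm
    rw [this]
    exact measurableSet_eq_fun (C.measurable_nextLoc.comp measurable_fst)
      (measurable_fst.comp measurable_snd)
  have h2 (v : V) : Measurable fun p : (C.Loc × C.Loc) × ((V → ℝ) × ℝ) =>
      p.2.2 ∈ (C.up p.1.1 p.1.2 v).possible v p.2.1 :=
    measurable_from_prod_countable_right fun p =>
      measurableSet_setOfPred.1 ((C.up p.1 p.2 v).measurableSet_possible v)
  refine h1.inter ?_
  have h3 : {p : C.State × C.State | ∀ v, p.2.2 v ∈ (C.up p.1.1 p.2.1 v).possible v p.1.2} =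
      ⋂ v, {p | p.2.2 v ∈ (C.up p.1.1 p.2.1 v).possible v p.1.2} := Set.ofPred_forall _
  refine MeasurableSet.congr ?_ h3.symm
  exact MeasurableSet.iInter fun v => measurableSet_setOfPred.2 ((h2 v).comp
    (f := fun p : C.State × C.State => ((p.1.1, p.2.1), (p.1.2, p.2.2 v))) (by fun_prop))

/-- Almost every sequence of states is a run: transitions respect the control flow, and sampled
values lie in the support of their distribution. -/
theorem ae_mem_run : ∀ᵐ ρ ∂C.runMeasure, ρ ∈ C.Run := by
  refine (ae_chainMeasure_zero C.stepKernel _).and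
    (ae_chainMeasure_succ C.stepKernel _ C.measurableSet_succ fun s => ?_)
  refine (ae_map_iff measurable_prodMk_left.aemeasurable
    (measurable_prodMk_left C.measurableSet_succ)).2 ?_
  have h : ∀ᵐ y ∂VarUpdate.jointLaw (C.up s.1 (C.nextLoc s)) s.2,
      ∀ v, y v ∈ (C.up s.1 (C.nextLoc s) v).possible v s.2 := by
    refine ae_all_iff.2 fun v => ?_
    exact (Measure.quasiMeasurePreserving_eval (fun v =>
      (C.up s.1 (C.nextLoc s) v).law v s.2) v).ae
        ((C.up s.1 (C.nextLoc s) v).ae_mem_possible v s.2)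
  filter_upwards [h] with y hy
  exact ⟨(C.nextLoc_eq_iff s _).1 rfl, hy⟩

theorem term_ae_eq : C.Term =ᵐ[C.runMeasure] C.Reach := by
  filter_upwards [C.ae_mem_run] with ρ hρ
  exact propext ⟨fun h => h.2, fun h => ⟨hρ, h⟩⟩

theorem output_ae_eq (B : Set (O → ℝ)) : C.Output B =ᵐ[C.runMeasure] C.ReachOutput B := by
  filter_upwards [C.term_ae_eq] with ρ hρ
  exact congrArg (· ∧ (fun o => (ρ (C.termTime ρ)).2 (C.out o)) ∈ B) hρ

theorem asTerminating_iff : C.ASTerminating ↔ ∀ᵐ ρ ∂C.runMeasure, ρ ∈ C.Reach := by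
  rw [ASTerminating, measure_congr C.term_ae_eq, ← prob_compl_eq_zero_iff C.measurableSet_reach]
  rfl

theorem expWeight_eq :
    C.expWeight = ∫⁻ ρ in C.Reach, (C.cumWeight ρ : ℝ≥0∞) ∂C.runMeasure :=
  setLIntegral_congr C.term_ae_eq

theorem nod_eq (B : Set (O → ℝ)) :
    C.nod B = (∫⁻ ρ in C.ReachOutput B, (C.cumWeight ρ : ℝ≥0∞) ∂C.runMeasure) / C.expWeight := by
  rw [nod, setLIntegral_congr (C.output_ae_eq B)]

end PCFG

/-! ### The chain stopped at the terminal location -/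

namespace PCFG

variable {V O : Type} (C : PCFG V O)

open Classical in
/-- One step of the stopped chain, together with its accumulated weight. -/
noncomputable def stopStep (z : C.State × ℝ≥0) (t : C.State) : C.State × ℝ≥0 :=
  if z.1.1 = C.locOut then z else (t, z.2 * C.weight z.1.1 t.1 z.1.2)

/-- The state and the accumulated weight at time `n` of a sequence of states that is stopped when it
first reaches the terminal location. -/
noncomputable def stopped : ℕ → (ℕ → C.State) → C.State × ℝ≥0
  | 0, ρ => (ρ 0, 1)
  | n + 1, ρ => C.stopStep (stopped n ρ) (ρ (n + 1))

theorem measurable_stopStep :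
    Measurable fun p : (C.State × ℝ≥0) × C.State => C.stopStep p.1 p.2 := by
  classical
  refine Measurable.ite (measurable_fst.comp (measurable_fst.comp measurable_fst)
    (measurableSet_singleton C.locOut)) measurable_fst ?_
  exact measurable_snd.prodMk ((measurable_snd.comp measurable_fst).mul
    (C.measurable_stepWeight.comp
      (f := fun p : (C.State × ℝ≥0) × C.State => (p.1.1, p.2)) (by fun_prop)))

theorem measurable_stopped (n : ℕ) : Measurable (C.stopped n) := by
  induction n with
  | zero => exact (measurable_pi_apply 0).prodMk measurable_const
  | succ n ih =>
    exact C.measurable_stopStep.comp (f := fun ρ => (C.stopped n ρ, ρ (n + 1)))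
      (ih.prodMk (measurable_pi_apply _))

variable {C}

theorem stopped_congr {n : ℕ} {ρ ρ' : ℕ → C.State} (h : ∀ i ≤ n, ρ i = ρ' i) :
    C.stopped n ρ = C.stopped n ρ' := by
  induction n with
  | zero => simp [stopped, h]
  | succ n ih => rw [stopped, stopped, ih fun i hi => h i (by omega), h _ le_rfl]

theorem stopped_eq_of_forall_ne {n : ℕ} {ρ : ℕ → C.State} (h : ∀ m < n, (ρ m).1 ≠ C.locOut) :
    C.stopped n ρ =
      (ρ n, ∏ i ∈ Finset.range n, C.weight (ρ i).1 (ρ (i + 1)).1 (ρ i).2) := by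
  induction n with
  | zero => simp [stopped]
  | succ n ih =>
    rw [stopped, ih fun m hm => h m (by omega), stopStep, if_neg (h n (by omega)),
      Finset.prod_range_succ]

theorem stopped_eq_of_termTime_le {n : ℕ} {ρ : ℕ → C.State} (hρ : ρ ∈ C.Reach)
    (h : C.termTime ρ ≤ n) : C.stopped n ρ = (ρ (C.termTime ρ), C.cumWeight ρ) := by
  induction n, h using Nat.le_induction with
  | base => exact stopped_eq_of_forall_ne fun m => fst_ne_of_lt_termTime
  | succ n hn ih => rw [stopped, ih, stopStep, if_pos (fst_termTime hρ)]

theorem fst_stopped {n : ℕ} {ρ : ℕ → C.State} (h : (C.stopped n ρ).1.1 ≠ C.locOut) :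
    (C.stopped n ρ).1 = ρ n := by
  by_cases hex : ∃ m < n, (ρ m).1 = C.locOut
  · obtain ⟨m, hm, hout⟩ := hex
    have hρ : ρ ∈ C.Reach := ⟨m, hout⟩
    refine absurd ?_ h
    rw [stopped_eq_of_termTime_le hρ ((Nat.sInf_le hout).trans hm.le)]
    exact fst_termTime hρ
  · push Not at hex
    rw [stopped_eq_of_forall_ne hex]

variable [Fintype V]

theorem lintegral_stopped_succ (n : ℕ) {f : C.State × ℝ≥0 → ℝ≥0∞} (hf : Measurable f) :
    ∫⁻ ρ, f (C.stopped (n + 1) ρ) ∂C.runMeasure =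
      ∫⁻ ρ, ∫⁻ t, f (C.stopStep (C.stopped n ρ) t) ∂C.stepKernel (ρ n) ∂C.runMeasure :=
  lintegral_chainMeasure_succ C.stepKernel (C.locIn, C.valIn) n (C.measurable_stopped n)
    (fun ρ => stopped_congr fun i hi => by rw [min_eq_left hi])
    (f := fun p => f (C.stopStep p.1 p.2)) (hf.comp C.measurable_stopStep)

/-- Backward induction: if `f (k + 1)` is the expectation of `f k` after one step of the chain that
is stopped at the terminal location, then the expectation of `f 0` after `n` steps is `f n` at the
initial state. -/
theorem lintegral_stopped {f : ℕ → C.State × ℝ≥0 → ℝ≥0∞} (hf : ∀ k, Measurable (f k))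
    (hout : ∀ k s w, s.1 = C.locOut → f (k + 1) (s, w) = f k (s, w))
    (hstep : ∀ k s w, s.1 ≠ C.locOut →
      f (k + 1) (s, w) = ∫⁻ t, f k (t, w * C.weight s.1 t.1 s.2) ∂C.stepKernel s) (n : ℕ) :
    ∫⁻ ρ, f 0 (C.stopped n ρ) ∂C.runMeasure = f n ((C.locIn, C.valIn), 1) := by
  suffices H : ∀ k, ∫⁻ ρ, f k (C.stopped n ρ) ∂C.runMeasure =
      f (k + n) ((C.locIn, C.valIn), 1) by simpa using H 0
  induction n with
  | zero =>
    intro k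
    have h : ∀ᵐ ρ ∂C.runMeasure, f k (C.stopped 0 ρ) = f k ((C.locIn, C.valIn), 1) := by
      filter_upwards [C.ae_mem_run] with ρ hρ
      rw [stopped, hρ.1]
    simp [lintegral_congr_ae h]
  | succ n ih =>
    intro k
    rw [lintegral_stopped_succ n (hf k), show k + (n + 1) = k + 1 + n by omega, ← ih (k + 1)]
    refine lintegral_congr fun ρ => ?_
    by_cases h : (C.stopped n ρ).1.1 = C.locOut
    · simp [stopStep, h, hout k _ (C.stopped n ρ).2 h]
    · simp only [stopStep, h, if_false]
      rw [← fst_stopped h, ← hstep k _ _ h]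

/-- Optional stopping: a bounded function of the state and the accumulated weight that is
preserved in expectation by the steps of the chain before termination has, at the termination of
an almost surely terminating chain, its initial value as expectation. -/
theorem lintegral_termTime {f : C.State × ℝ≥0 → ℝ≥0∞} (hf : Measurable f) (h1 : ∀ z, f z ≤ 1)
    (hstep : ∀ s w, s.1 ≠ C.locOut →
      f (s, w) = ∫⁻ t, f (t, w * C.weight s.1 t.1 s.2) ∂C.stepKernel s)
    (hterm : ∀ᵐ ρ ∂C.runMeasure, ρ ∈ C.Reach) :
    ∫⁻ ρ, f (ρ (C.termTime ρ), C.cumWeight ρ) ∂C.runMeasure = f ((C.locIn, C.valIn), 1) := by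
  have hlim := tendsto_lintegral_of_dominated_convergence (μ := C.runMeasure)
    (F := fun n ρ => f (C.stopped n ρ)) (f := fun ρ => f (ρ (C.termTime ρ), C.cumWeight ρ))
    (fun _ => 1) (fun n => hf.comp (C.measurable_stopped n))
    (fun n => Filter.Eventually.of_forall fun ρ => h1 _) (by simp) (by
      filter_upwards [hterm] with ρ hρ
      refine tendsto_const_nhds.congr' ?_
      filter_upwards [Filter.eventually_ge_atTop (C.termTime ρ)] with n hn
      rw [stopped_eq_of_termTime_le hρ hn])
  refine tendsto_nhds_unique hlim (tendsto_const_nhds.congr fun n => ?_)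
  exact (lintegral_stopped (f := fun _ => f) (fun _ => hf) (fun _ _ _ _ => rfl)
    (fun _ s w => hstep s w) n).symm

/-! ### Hitting probabilities -/

variable (C)

open Classical in
/-- The probability that the chain started at a state reaches the terminal location within `n` steps
with a valuation in `A`. -/
noncomputable def hitBefore (A : Set (V → ℝ)) : ℕ → C.State → ℝ≥0∞
  | 0, s => if s.1 = C.locOut ∧ s.2 ∈ A then 1 else 0
  | n + 1, s => if s.1 = C.locOut then hitBefore A 0 s
      else ∫⁻ t, hitBefore A n t ∂C.stepKernel s

/-- The probability that the chain started at a state reaches the terminal location with a valuation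
in `A`. -/
noncomputable def hit (A : Set (V → ℝ)) (s : C.State) : ℝ≥0∞ := ⨆ n, C.hitBefore A n s

variable {C} {A : Set (V → ℝ)}

theorem measurable_hitBefore (hA : MeasurableSet A) (n : ℕ) : Measurable (C.hitBefore A n) := by
  classical
  have hout : MeasurableSet {s : C.State | s.1 = C.locOut} :=
    measurable_fst (measurableSet_singleton C.locOut)
  have h0 : Measurable (C.hitBefore A 0) := by
    have h : C.hitBefore A 0 = fun s => if s.1 = C.locOut ∧ s.2 ∈ A then 1 else 0 := by
      funext s; rw [hitBefore]
    rw [h]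
    exact Measurable.ite (hout.inter (measurable_snd hA)) measurable_const measurable_const
  cases n with
  | zero => exact h0
  | succ n =>
    have h : C.hitBefore A (n + 1) = fun s => if s.1 = C.locOut then C.hitBefore A 0 s
        else ∫⁻ t, C.hitBefore A n t ∂C.stepKernel s := by
      funext s; simp only [hitBefore]
    rw [h]
    exact Measurable.ite hout h0 (measurable_hitBefore hA n).lintegral_kernel

theorem hitBefore_of_eq (n : ℕ) {s : C.State} (h : s.1 = C.locOut) :
    C.hitBefore A n s = C.hitBefore A 0 s := by
  cases n <;> simp [hitBefore, h]

theorem hitBefore_zero_le (s : C.State) : C.hitBefore A 0 s ≤ 1 := by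
  rw [hitBefore]; split_ifs <;> simp

theorem hitBefore_le_one (n : ℕ) (s : C.State) : C.hitBefore A n s ≤ 1 := by
  induction n generalizing s with
  | zero => exact hitBefore_zero_le s
  | succ n ih =>
    rw [hitBefore]
    split_ifs
    · exact hitBefore_zero_le s
    · exact (lintegral_mono ih).trans (by simp)

theorem hitBefore_mono (s : C.State) : Monotone fun n => C.hitBefore A n s := by
  refine monotone_nat_of_le_succ fun n => ?_
  induction n generalizing s with
  | zero =>
    by_cases h : s.1 = C.locOut
    · exact (hitBefore_of_eq 1 h).ge
    · simp [hitBefore, h]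
  | succ n ih =>
    by_cases h : s.1 = C.locOut
    · exact (hitBefore_of_eq _ h).trans_le (hitBefore_of_eq (n + 2) h).ge
    · rw [hitBefore, if_neg h, hitBefore, if_neg h]
      exact lintegral_mono ih

theorem measurable_hit (hA : MeasurableSet A) : Measurable (C.hit A) :=
  Measurable.iSup fun n => measurable_hitBefore hA n

theorem hit_le_one (s : C.State) : C.hit A s ≤ 1 := iSup_le fun n => hitBefore_le_one n s

open Classical in
theorem hit_of_eq {s : C.State} (h : s.1 = C.locOut) :
    C.hit A s = if s.2 ∈ A then 1 else 0 := by
  simp only [hit, hitBefore_of_eq _ h, ciSup_const]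
  simp [hitBefore, h]

theorem hit_of_ne (hA : MeasurableSet A) {s : C.State} (h : s.1 ≠ C.locOut) :
    C.hit A s = ∫⁻ t, C.hit A t ∂C.stepKernel s := by
  simp only [hit]
  rw [lintegral_iSup (fun n => measurable_hitBefore hA n)
    (fun m n hmn s => hitBefore_mono s hmn), ← (hitBefore_mono s).iSup_nat_add 1]
  simp [hitBefore, h]

/-- The hitting probability, defined by iterating one-step expectations, is the probability of the
corresponding set of sequences. -/
theorem hit_init (hA : MeasurableSet A) :
    C.hit A (C.locIn, C.valIn) =
      C.runMeasure (C.Reach ∩ {ρ | (ρ (C.termTime ρ)).2 ∈ A}) := by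
  classical
  have hS : MeasurableSet (C.Reach ∩ {ρ | (ρ (C.termTime ρ)).2 ∈ A}) :=
    C.measurableSet_reach.inter ((measurable_snd.comp C.measurable_state_termTime) hA)
  have hn (n : ℕ) : C.hitBefore A n (C.locIn, C.valIn) =
      ∫⁻ ρ, C.hitBefore A 0 (C.stopped n ρ).1 ∂C.runMeasure :=
    (lintegral_stopped (f := fun k z => C.hitBefore A k z.1)
      (fun k => (measurable_hitBefore hA k).comp measurable_fst)
      (fun k s _ h => (hitBefore_of_eq (k + 1) h).trans (hitBefore_of_eq k h).symm)
      (fun k s _ h => by simp [hitBefore, h]) n).symm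
  have hval (n : ℕ) (ρ : ℕ → C.State) : C.hitBefore A 0 (C.stopped n ρ).1 =
      if C.termTime ρ ≤ n then (C.Reach ∩ {ρ | (ρ (C.termTime ρ)).2 ∈ A}).indicator 1 ρ
        else 0 := by
    by_cases hρ : ρ ∈ C.Reach
    · split_ifs with h
      · rw [stopped_eq_of_termTime_le hρ h]
        simp [hitBefore, fst_termTime hρ, Set.indicator_apply, hρ]
      · have hlt := not_le.1 h
        rw [stopped_eq_of_forall_ne fun m hm => fst_ne_of_lt_termTime (hm.trans hlt)]
        simp [hitBefore, fst_ne_of_lt_termTime hlt]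
    · have hne (m : ℕ) : (ρ m).1 ≠ C.locOut := fun h => hρ ⟨m, h⟩
      rw [stopped_eq_of_forall_ne fun m _ => hne m]
      simp [hitBefore, hne, hρ]
  rw [← lintegral_indicator_one hS, hit]
  simp only [hn]
  have hm (n : ℕ) : Measurable fun ρ => C.hitBefore A 0 (C.stopped n ρ).1 :=
    ((measurable_hitBefore hA 0).comp measurable_fst).comp (C.measurable_stopped n)
  rw [← lintegral_iSup hm]
  · refine lintegral_congr fun ρ => le_antisymm (iSup_le fun n => ?_) ?_
    · rw [hval]; split_ifs <;> simp
    · refine le_trans ?_ (le_iSup _ (C.termTime ρ))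
      rw [hval, if_pos le_rfl]
  · intro m n hmn ρ
    simp only [hval]
    split_ifs with h h'
    · exact le_rfl
    · exact absurd (h.trans hmn) h'
    · exact zero_le
    · exact le_rfl

end PCFG

/-! ### One step of a program -/

namespace VarUpdate

variable {V : Type} [Fintype V]

theorem jointLaw_keep (x : V → ℝ) :
    jointLaw (fun _ : V => VarUpdate.keep) x = Measure.dirac x := by
  refine Measure.pi_eq fun s hs => ?_
  classical
  rw [Measure.dirac_apply' _ (MeasurableSet.univ_pi hs)]
  simp only [law, Measure.dirac_apply' _ (hs _), Set.indicator_apply, Pi.one_apply,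
    Set.mem_univ_pi]
  split_ifs with h
  · simp [h]
  · push Not at h
    obtain ⟨v, hv⟩ := h
    exact (Finset.prod_eq_zero (Finset.mem_univ v) (by simp [hv])).symm

open Classical in
theorem jointLaw_ite (v : V) (u : VarUpdate V) (x : V → ℝ) :
    jointLaw (fun v' => if v' = v then u else VarUpdate.keep) x =
      (u.law v x).map (Function.update x v) := by
  refine Measure.pi_eq fun s hs => ?_
  rw [Measure.map_apply (measurable_update x) (MeasurableSet.univ_pi hs),
    ← Finset.mul_prod_erase _ _ (Finset.mem_univ v)]
  beta_reduce
  rw [if_pos rfl]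
  have hpre : Function.update x v ⁻¹' Set.univ.pi s =
      {r | r ∈ s v ∧ ∀ v' ≠ v, x v' ∈ s v'} := by
    ext r
    simp only [Set.mem_preimage, Set.mem_univ_pi, Set.mem_ofPred_eq]
    rw [← Function.forall_update_iff x (p := fun v' y => y ∈ s v')]
  have hprod : ∏ v' ∈ Finset.univ.erase v,
      ((if v' = v then u else VarUpdate.keep).law v' x) (s v') =
        if ∀ v' ≠ v, x v' ∈ s v' then 1 else 0 := by
    have h1 : ∀ v' ∈ Finset.univ.erase v,
        ((if v' = v then u else VarUpdate.keep).law v' x) (s v') =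
          if x v' ∈ s v' then 1 else 0 := fun v' hv' => by
      rw [if_neg (Finset.ne_of_mem_erase hv'), law, Measure.dirac_apply' _ (hs v'),
        Set.indicator_apply]
      rfl
    rw [Finset.prod_congr rfl h1]
    split_ifs with h
    · exact Finset.prod_eq_one fun v' hv' => if_pos (h v' (Finset.ne_of_mem_erase hv'))
    · push Not at h
      obtain ⟨v', hne, hv'⟩ := h
      exact Finset.prod_eq_zero (Finset.mem_erase.2 ⟨hne, Finset.mem_univ _⟩) (if_neg hv')
  rw [hpre, hprod]
  split_ifs with h
  · rw [mul_one]
    exact congrArg _ (Set.ext fun r => and_iff_left h)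
  · simp only [h, and_false, mul_zero]
    exact measure_empty

end VarUpdate

namespace Node

variable {V L : Type} [Fintype V]

/-- The expectation of a function of the next location and valuation, when the instruction is
executed from the valuation `x`. -/
noncomputable def expect (N : Node V L) (f : L → (V → ℝ) → ℝ≥0∞) (x : V → ℝ) : ℝ≥0∞ :=
  ∫⁻ y, f (N.dest x) y ∂VarUpdate.jointLaw N.up x

variable {f : L → (V → ℝ) → ℝ≥0∞} {x : V → ℝ}

theorem expect_step_keep (w : (V → ℝ) → ℝ≥0) (hw : Measurable w) (next : L) :
    (step (fun _ => VarUpdate.keep) w hw next).expect f x = f next x := by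
  simp only [expect, up, dest, VarUpdate.jointLaw_keep, lintegral_dirac]

open Classical in
theorem expect_branch (φ : Set (V → ℝ)) (hφ : MeasurableSet φ) (yes no : L) :
    (branch φ hφ yes no).expect f x = if x ∈ φ then f yes x else f no x := by
  simp only [expect, up, dest, VarUpdate.jointLaw_keep, lintegral_dirac]
  split_ifs <;> rfl

open Classical in
theorem expect_set (v : V) (u : VarUpdate V) (next : L) (hf : Measurable (f next)) :
    (Node.set v u next).expect f x = ∫⁻ r, f next (Function.update x v r) ∂u.law v x := by
  simp only [expect, Node.set, up, dest]
  rw [VarUpdate.jointLaw_ite, lintegral_map hf (measurable_update x)]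

open Classical in
theorem expect_set_expr (v : V) (e : (V → ℝ) → ℝ) (he : Measurable e) (next : L)
    (hf : Measurable (f next)) :
    (Node.set v (VarUpdate.expr e he) next).expect f x = f next (Function.update x v (e x)) := by
  rw [expect_set v _ next hf, VarUpdate.law, lintegral_dirac]

end Node

namespace Program

variable {V O Λ : Type} [DecidableEq Λ] (P : Program V O Λ)

theorem nextLoc_pcfg (s : P.pcfg.State) : P.pcfg.nextLoc s = (P.node s.1).dest s.2 :=
  (P.pcfg.nextLoc_eq_iff s _).2 ⟨(P.node s.1).dest_mem_targets s.2, rfl⟩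

theorem lintegral_stepKernel [Fintype V] (l : Option P.body.Loc) (x : V → ℝ)
    {f : P.pcfg.State → ℝ≥0∞} (hf : Measurable f) :
    ∫⁻ t, f t ∂P.pcfg.stepKernel (l, x) = (P.node l).expect (fun l' y => f (l', y)) x := by
  rw [PCFG.lintegral_stepKernel _ _ hf, nextLoc_pcfg]
  rfl

end Program

/-! ### Conditioning-free programs -/

namespace Stmt

variable {V Λ : Type}

theorem ConditioningFree.weight_node {L : Type} {tgt : Λ → L} {s : Stmt V Λ}
    (h : s.ConditioningFree) (emb : s.Loc → L) (next : L) (l : s.Loc) (x : V → ℝ) :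
    (s.node tgt emb next l).weight x = 1 := by
  induction s generalizing next with
  | skip => rfl
  | assign => rfl
  | sample => rfl
  | observe => exact h.elim
  | score => exact h.elim
  | seq s t ihs iht =>
    cases l with
    | inl l => exact ihs h.1 _ _ l
    | inr l => exact iht h.2 _ _ l
  | ite φ hφ s t ihs iht =>
    match l with
    | none => rfl
    | some (Sum.inl l) => exact ihs h.1 _ _ l
    | some (Sum.inr l) => exact iht h.2 _ _ l
  | label a s ih => exact ih h _ _ l
  | goto => rfl
  | _ =>
    -- The remaining case is the loop.
    rename_i φ hφ s ih
    match l with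
    | none => rfl
    | some l => exact ih h _ _ l

theorem conditioningFree_trackWeight (s : Stmt V Λ) : s.trackWeight.ConditioningFree := by
  induction s <;> simp_all [trackWeight, ConditioningFree]

theorem conditioningFree_resetVars (x : V → ℝ) (vs : List V) :
    (resetVars (Λ := Λ) x vs).ConditioningFree := by
  induction vs <;> simp_all [resetVars, ConditioningFree]

theorem conditioningFree_restartBlock [Fintype V] (M : ℝ) (x : V → ℝ) :
    (restartBlock (Λ := Λ) M x).ConditioningFree := by
  simp [restartBlock, ifProb, ConditioningFree, conditioningFree_resetVars]

end Stmt

namespace Program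

variable {V O Λ : Type}

theorem conditioningFree_restart [Fintype V] (P : Program V O Λ) (M : ℝ) :
    (P.restart M).ConditioningFree :=
  ⟨P.body.conditioningFree_trackWeight, Stmt.conditioningFree_restartBlock M P.valIn⟩

theorem ConditioningFree.cumWeight_eq_one [DecidableEq Λ] {P : Program V O Λ}
    (h : P.ConditioningFree) (ρ : ℕ → P.pcfg.State) : P.pcfg.cumWeight ρ = 1 := by
  refine Finset.prod_eq_one fun i _ => ?_
  change (P.node (ρ i).1).weight (ρ i).2 = 1
  match (ρ i).1 with
  | none => rfl
  | some l => exact Stmt.ConditioningFree.weight_node h _ _ _ _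

end Program

/-! ### The instrumented program simulates the original one -/

namespace ResVar

variable {V : Type}

/-- The valuation with old variables `x`, weight `w` and coin `c`. -/
def mk (x : V → ℝ) (w c : ℝ) : ResVar V → ℝ := Sum.elim x ![w, c]

@[simp] theorem mk_inl (x : V → ℝ) (w c : ℝ) (v : V) : mk x w c (Sum.inl v) = x v := rfl

@[simp] theorem mk_weight (x : V → ℝ) (w c : ℝ) : mk x w c weight = w := rfl

@[simp] theorem old_mk (x : V → ℝ) (w c : ℝ) : old (mk x w c) = x := rfl

theorem measurable_mk :
    Measurable fun p : (V → ℝ) × ℝ × ℝ => mk p.1 p.2.1 p.2.2 := by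
  refine measurable_pi_lambda _ fun v => ?_
  match v with
  | Sum.inl v => exact (measurable_pi_apply v).comp measurable_fst
  | Sum.inr 0 => exact measurable_fst.comp measurable_snd
  | Sum.inr 1 => exact measurable_snd.comp measurable_snd

@[simp] theorem update_mk_inl [DecidableEq V] [DecidableEq (ResVar V)] (x : V → ℝ)
    (w c : ℝ) (v : V) (r : ℝ) :
    Function.update (mk x w c) (Sum.inl v) r = mk (Function.update x v r) w c :=
  Sum.update_elim_inl

@[simp] theorem update_mk_weight [DecidableEq (ResVar V)] (x : V → ℝ) (w c r : ℝ) :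
    Function.update (mk x w c) weight r = mk x r c := by
  funext v
  match v with
  | Sum.inl v => simp [mk]
  | Sum.inr 0 => simp [mk]
  | Sum.inr 1 => simp [mk]

@[simp] theorem update_mk_coin [DecidableEq (ResVar V)] (x : V → ℝ) (w c r : ℝ) :
    Function.update (mk x w c) coin r = mk x w r := by
  funext v
  match v with
  | Sum.inl v => simp [mk]
  | Sum.inr 0 => simp [mk]
  | Sum.inr 1 => simp [mk]

end ResVar

namespace Stmt

variable {V Λ : Type}

/-- The location of the instrumented statement at which the simulation of the instruction at a
location of the original statement starts. -/
def trackLoc : (s : Stmt V Λ) → s.Loc → s.trackWeight.Loc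
  | skip => fun _ => ()
  | assign _ _ _ => fun _ => ()
  | sample _ _ => fun _ => ()
  | observe _ _ => fun _ => none
  | score _ _ => fun _ => ()
  | seq s t => Sum.map s.trackLoc t.trackLoc
  | ite _ _ s t => Option.map (Sum.map s.trackLoc t.trackLoc)
  | .while _ _ s => Option.map s.trackLoc
  | label _ s => s.trackLoc
  | goto _ => fun _ => ()

theorem trackLoc_entry (s : Stmt V Λ) : s.trackLoc s.entry = s.trackWeight.entry := by
  induction s with
  | seq s t ihs _ => exact congrArg Sum.inl ihs
  | label a s ih => exact ih
  | _ => rfl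

theorem find_trackWeight [DecidableEq Λ] (s : Stmt V Λ) (a : Λ) :
    s.trackWeight.find (some a) = (s.find a).map s.trackLoc := by
  induction s with
  | seq s t ihs iht =>
    simp only [trackWeight, find, ihs, iht, trackLoc]
    cases s.find a <;> cases t.find a <;> rfl
  | ite φ hφ s t ihs iht =>
    simp only [trackWeight, find, ihs, iht, trackLoc]
    cases s.find a <;> cases t.find a <;> rfl
  | label b s ih =>
    by_cases h : b = a
    · have h1 : (label b s).trackWeight.find (some a) = some s.trackWeight.entry :=
        if_pos (congrArg some h)
      have h2 : (label b s).find a = some s.entry := if_pos h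
      rw [h1, h2]
      exact congrArg some s.trackLoc_entry.symm
    · have h1 : (label b s).trackWeight.find (some a) = s.trackWeight.find (some a) :=
        if_neg fun hc => h (Option.some_injective _ hc)
      have h2 : (label b s).find a = s.find a := if_neg h
      rw [h1, h2]
      exact ih
  | skip | assign | sample | observe | score | goto => rfl
  | _ =>
    -- The remaining case is the loop.
    rename_i φ hφ s ih
    simp only [trackWeight, find, ih, trackLoc]
    cases s.find a <;> rfl

theorem exists_find_eq_some [DecidableEq Λ] {s : Stmt V Λ} {a : Λ} (h : a ∈ s.labels) :
    ∃ l, s.find a = some l := by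
  induction s with
  | seq s t ihs iht =>
    rcases hs : s.find a with _ | l
    · obtain ⟨l, hl⟩ := iht ((List.mem_append.1 h).resolve_left fun h => by simpa [hs] using ihs h)
      exact ⟨Sum.inr l, by rw [find, hs, hl]; rfl⟩
    · exact ⟨Sum.inl l, by rw [find, hs]; rfl⟩
  | ite φ hφ s t ihs iht =>
    rcases hs : s.find a with _ | l
    · obtain ⟨l, hl⟩ := iht ((List.mem_append.1 h).resolve_left fun h => by simpa [hs] using ihs h)
      exact ⟨some (Sum.inr l), by rw [find, hs, hl]; rfl⟩
    · exact ⟨some (Sum.inl l), by rw [find, hs]; rfl⟩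
  | label b s ih =>
    by_cases hb : b = a
    · exact ⟨s.entry, if_pos hb⟩
    · obtain ⟨l, hl⟩ := ih ((List.mem_cons.1 h).resolve_left fun h => hb h.symm)
      exact ⟨l, (if_neg hb).trans hl⟩
  | skip | assign | sample | observe | score | goto => simp [labels] at h
  | _ =>
    -- The remaining case is the loop.
    rename_i φ hφ s ih
    obtain ⟨l, hl⟩ := ih h
    exact ⟨some l, by rw [find, hl]; rfl⟩

/-- One step of the original statement has the same effect on a function `H` as the simulating steps
of the instrumented one, provided `H` is preserved in expectation by the latter. The locations of
the graph around the original statement are mapped to those of the other graph by `σ`. -/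
theorem eq_expect_of_trackWeight [Fintype V] {L L' : Type} {tgt : Λ → L}
    {tgt' : Option Λ → L'} {H : L' → (ResVar V → ℝ) → ℝ≥0∞} (hH : ∀ l, Measurable (H l))
    {σ : L → L'} (s : Stmt V Λ) {emb : s.Loc → L} {emb' : s.trackWeight.Loc → L'} {next : L}
    (hemb : ∀ l, σ (emb l) = emb' (s.trackLoc l))
    (htgt : ∀ a ∈ s.gotos, σ (tgt a) = tgt' (some a))
    (hstep : ∀ l X, H (emb' l) X = (s.trackWeight.node tgt' emb' (σ next) l).expect H X)
    (l : s.Loc) (x : V → ℝ) (w : ℝ≥0) (c : ℝ) :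
    H (emb' (s.trackLoc l)) (ResVar.mk x w c) =
      (s.node tgt emb next l).expect
        (fun k y => H (σ k) (ResVar.mk y ((w * (s.node tgt emb next l).weight x : ℝ≥0) : ℝ) c))
        x := by
  classical
  have hmeas (k : L') (w c : ℝ) : Measurable fun y : V → ℝ => H k (ResVar.mk y w c) :=
    (hH k).comp (ResVar.measurable_mk.comp (f := fun y : V → ℝ => (y, w, c)) (by fun_prop))
  induction s generalizing next with
  | skip =>
    refine (hstep () _).trans ?_
    simp only [trackWeight, node, Node.jump, Node.expect_step_keep, Node.weight, mul_one]
  | assign v e he =>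
    refine (hstep () _).trans ?_
    simp only [trackWeight, node]
    rw [Node.expect_set_expr _ _ _ _ (hH _), Node.expect_set_expr _ _ _ _ (hmeas _ _ _)]
    simp [Node.weight, Node.set]
  | sample v d =>
    refine (hstep () _).trans ?_
    simp only [trackWeight, node]
    rw [Node.expect_set _ _ _ (hH _), Node.expect_set _ _ _ (hmeas _ _ _)]
    simp [Node.weight, Node.set, VarUpdate.law]
  | observe φ hφ =>
    refine (hstep none _).trans ?_
    simp only [trackWeight, node, Node.expect_branch, Node.check, Node.expect_step_keep,
      Node.weight]
    by_cases hx : x ∈ φ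
    · simp only [Set.mem_compl_iff, Set.mem_preimage, ResVar.old_mk, hx, not_true_eq_false,
        if_false, if_true, mul_one]
      refine (hstep (some (Sum.inr ())) _).trans ?_
      simp only [trackWeight, node, Node.jump, Node.expect_step_keep]
    · simp only [Set.mem_compl_iff, Set.mem_preimage, ResVar.old_mk, hx, not_false_eq_true,
        if_false, if_true, mul_zero]
      refine (hstep (some (Sum.inl ())) _).trans ?_
      simp only [trackWeight, node]
      rw [Node.expect_set_expr _ _ _ _ (hH _)]
      simp
  | score e he =>
    refine (hstep () _).trans ?_
    simp only [trackWeight, node, Node.weigh, Node.expect_step_keep, Node.weight]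
    rw [Node.expect_set_expr _ _ _ _ (hH _)]
    simp
  | seq s t ihs iht =>
    cases l with
    | inl l =>
      refine ihs (emb := fun k => emb (Sum.inl k)) (emb' := fun k => emb' (Sum.inl k))
        (next := emb (Sum.inr t.entry)) (fun k => hemb (Sum.inl k))
        (fun a ha => htgt a (List.mem_append_left _ ha)) (fun k X => ?_) l
      have hnext : σ (emb (Sum.inr t.entry)) = emb' (Sum.inr t.trackWeight.entry) :=
        (hemb _).trans (congrArg (fun k => emb' (Sum.inr k)) t.trackLoc_entry)
      rw [hnext]
      exact hstep (Sum.inl k) X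
    | inr l =>
      exact iht (emb := fun k => emb (Sum.inr k)) (emb' := fun k => emb' (Sum.inr k))
        (fun k => hemb (Sum.inr k)) (fun a ha => htgt a (List.mem_append_right _ ha))
        (fun k X => hstep (Sum.inr k) X) l
  | ite φ hφ s t ihs iht =>
    match l with
    | none =>
      refine (hstep none _).trans ?_
      have hyes : σ (emb (some (Sum.inl s.entry))) = emb' (some (Sum.inl s.trackWeight.entry)) :=
        (hemb _).trans (congrArg (fun k => emb' (some (Sum.inl k))) s.trackLoc_entry)
      have hno : σ (emb (some (Sum.inr t.entry))) = emb' (some (Sum.inr t.trackWeight.entry)) :=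
        (hemb _).trans (congrArg (fun k => emb' (some (Sum.inr k))) t.trackLoc_entry)
      simp only [trackWeight, node, Node.expect_branch, Node.weight, mul_one]
      rw [hyes, hno]
      rfl
    | some (Sum.inl l) =>
      exact ihs (emb := fun k => emb (some (Sum.inl k)))
        (emb' := fun k => emb' (some (Sum.inl k)))
        (fun k => hemb (some (Sum.inl k))) (fun a ha => htgt a (List.mem_append_left _ ha))
        (fun k X => hstep (some (Sum.inl k)) X) l
    | some (Sum.inr l) =>
      exact iht (emb := fun k => emb (some (Sum.inr k)))
        (emb' := fun k => emb' (some (Sum.inr k)))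
        (fun k => hemb (some (Sum.inr k))) (fun a ha => htgt a (List.mem_append_right _ ha))
        (fun k X => hstep (some (Sum.inr k)) X) l
  | label a s ih => exact ih hemb htgt hstep l
  | goto a =>
    refine (hstep () _).trans ?_
    simp only [trackWeight, node, Node.jump, Node.expect_step_keep, Node.weight, mul_one]
    rw [htgt a (by simp [gotos])]
  | _ =>
    -- The remaining case is the loop.
    rename_i φ hφ s ih
    match l with
    | none =>
      refine (hstep none _).trans ?_
      have hyes : σ (emb (some s.entry)) = emb' (some s.trackWeight.entry) :=
        (hemb _).trans (congrArg (fun k => emb' (some k)) s.trackLoc_entry)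
      simp only [trackWeight, node, Node.expect_branch, Node.weight, mul_one]
      rw [hyes]
      rfl
    | some l =>
      refine ih (emb := fun k => emb (some k)) (emb' := fun k => emb' (some k))
        (next := emb none) (fun k => hemb (some k)) htgt (fun k X => ?_) l
      have hnext : σ (emb none) = emb' none := hemb none
      rw [hnext]
      exact hstep (some k) X

end Stmt

/-! ### The restart block -/

namespace Stmt

variable {V Λ : Type} [Fintype V] {L : Type} {tgt : Option Λ → L}
  {H : L → (ResVar V → ℝ) → ℝ≥0∞}

open Classical in
theorem eq_of_resetVars (hH : ∀ l, Measurable (H l)) (x : V → ℝ) (vs : List V)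
    {emb : (resetVars (Λ := Λ) x vs).Loc → L} {next : L}
    (hstep : ∀ l X, H (emb l) X = ((resetVars x vs).node tgt emb next l).expect H X)
    (y : V → ℝ) (w c : ℝ) :
    H (emb (resetVars x vs).entry) (ResVar.mk y w c) =
      H next (ResVar.mk (fun v => if v ∈ vs then x v else y v) w c) := by
  induction vs generalizing y with
  | nil =>
    refine (hstep () _).trans ?_
    simp only [resetVars, node, Node.jump, Node.expect_step_keep, List.not_mem_nil, if_false]
  | cons v vs ih =>
    have h1 : H (emb (Sum.inl ())) (ResVar.mk y w c) =
        H (emb (Sum.inr (resetVars x vs).entry)) (ResVar.mk (Function.update y v (x v)) w c) := by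
      refine (hstep (Sum.inl ()) _).trans ?_
      simp only [resetVars, node]
      rw [Node.expect_set_expr _ _ _ _ (hH _)]
      simp only [ResVar.update_mk_inl]
    refine h1.trans ((ih (emb := fun k => emb (Sum.inr k)) (fun k X => hstep (Sum.inr k) X)
      _).trans ?_)
    congr 2
    funext v'
    by_cases hv : v' = v
    · subst hv; simp
    · simp [hv]

open Classical in
/-- The restart block draws a coin `r`, which is also the value left in the coin variable, and
either restarts from `x` with weight one or terminates. -/
theorem eq_of_restartBlock (hH : ∀ l, Measurable (H l)) {M : ℝ} {x : V → ℝ}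
    {emb : (restartBlock (Λ := Λ) M x).Loc → L} {next : L}
    (hstep : ∀ l X, H (emb l) X = ((restartBlock M x).node tgt emb next l).expect H X)
    (y : V → ℝ) (w c : ℝ) :
    H (emb (restartBlock M x).entry) (ResVar.mk y w c) =
      ∫⁻ r, (if r < 1 - w / M then H (tgt none) (ResVar.mk x 1 r) else H next (ResVar.mk y w r))
        ∂(uniformUnit : Measure ℝ) := by
  have hgoto (X) : H (emb (Sum.inr (some (Sum.inl (Sum.inr (Sum.inr ())))))) X =
      H (tgt none) X := by
    refine (hstep _ _).trans ?_
    simp only [restartBlock, ifProb, node, Node.jump, Node.expect_step_keep]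
  have hassign (z : V → ℝ) (w' c' : ℝ) :
      H (emb (Sum.inr (some (Sum.inl (Sum.inr (Sum.inl ())))))) (ResVar.mk z w' c') =
        H (tgt none) (ResVar.mk z 1 c') := by
    refine (hstep _ _).trans ?_
    simp only [restartBlock, ifProb, node]
    rw [Node.expect_set_expr _ _ _ _ (hH _)]
    simp only [ResVar.update_mk_weight]
    exact hgoto _
  have hreset (w' c' : ℝ) :
      H (emb (Sum.inr (some (Sum.inl (Sum.inl (resetVars x Finset.univ.toList).entry)))))
        (ResVar.mk y w' c') = H (tgt none) (ResVar.mk x 1 c') := by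
    refine (eq_of_resetVars hH x Finset.univ.toList (tgt := tgt)
      (emb := fun k => emb (Sum.inr (some (Sum.inl (Sum.inl k)))))
      (next := emb (Sum.inr (some (Sum.inl (Sum.inr (Sum.inl ()))))))
      (fun k X => hstep (Sum.inr (some (Sum.inl (Sum.inl k)))) X) y w' c').trans ?_
    simp only [Finset.mem_toList, Finset.mem_univ, if_true]
    exact hassign _ _ _
  have hskip (X) : H (emb (Sum.inr (some (Sum.inr ())))) X = H next X := by
    refine (hstep _ _).trans ?_
    simp only [restartBlock, ifProb, node, Node.jump, Node.expect_step_keep]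
  have hite (c' : ℝ) : H (emb (Sum.inr none)) (ResVar.mk y w c') =
      if c' < 1 - w / M then H (tgt none) (ResVar.mk x 1 c') else H next (ResVar.mk y w c') := by
    refine (hstep _ _).trans ?_
    simp only [restartBlock, ifProb, node, Node.expect_branch]
    rw [← hreset w c', ← hskip]
    rfl
  refine (hstep (Sum.inl ()) _).trans ?_
  simp only [restartBlock, ifProb, node]
  rw [Node.expect_set _ _ _ (hH _)]
  refine lintegral_congr fun r => ?_
  simp only [ResVar.update_mk_coin]
  exact hite r

end Stmt

theorem uniformUnit_Iio {t : ℝ} (h1 : t ≤ 1) :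
    (uniformUnit : Measure ℝ) (Set.Iio t) = ENNReal.ofReal t := by
  have h : Set.Iio t ∩ Set.Icc 0 1 = Set.Ico 0 t := by
    ext r
    simp only [Set.mem_inter_iff, Set.mem_Iio, Set.mem_Icc, Set.mem_Ico]
    constructor
    · rintro ⟨h, h', -⟩; exact ⟨h', h⟩
    · rintro ⟨h', h⟩; exact ⟨h, h', by linarith⟩
  change (volume.restrict (Set.Icc 0 1)) (Set.Iio t) = _
  rw [Measure.restrict_apply measurableSet_Iio, h, Real.volume_Ico, sub_zero]

theorem uniformUnit_compl_Iio {t : ℝ} (h0 : 0 ≤ t) :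
    (uniformUnit : Measure ℝ) (Set.Iio t)ᶜ = ENNReal.ofReal (1 - t) := by
  have h : Set.Ici t ∩ Set.Icc 0 1 = Set.Icc t 1 := by
    ext r
    simp only [Set.mem_inter_iff, Set.mem_Ici, Set.mem_Icc]
    constructor
    · rintro ⟨h, -, h'⟩; exact ⟨h, h'⟩
    · rintro ⟨h, h'⟩; exact ⟨h, h0.trans h, h'⟩
  change (volume.restrict (Set.Icc 0 1)) _ = _
  rw [Set.compl_Iio, Measure.restrict_apply measurableSet_Ici, h, Real.volume_Icc]

open Classical in
/-- The branching `if prob(t)` takes its two branches with probabilities `t` and `1 - t`. -/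
theorem lintegral_uniformUnit_ite {t : ℝ} (h0 : 0 ≤ t) (h1 : t ≤ 1) (a b : ℝ≥0∞) :
    ∫⁻ r, (if r < t then a else b) ∂(uniformUnit : Measure ℝ) =
      ENNReal.ofReal t * a + ENNReal.ofReal (1 - t) * b := by
  rw [← lintegral_add_compl _ (measurableSet_Iio (a := t)),
    setLIntegral_congr_fun (f := fun r => if r < t then a else b) (g := fun _ => a)
      measurableSet_Iio fun r hr => if_pos (Set.mem_Iio.1 hr),
    setLIntegral_congr_fun (f := fun r => if r < t then a else b) (g := fun _ => b)
      measurableSet_Iio.compl fun r hr => if_neg hr,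
    setLIntegral_const, setLIntegral_const, uniformUnit_Iio h1, uniformUnit_compl_Iio h0,
    mul_comm a, mul_comm b]

/-! ### The probability that the restarted program outputs a value in a set -/

theorem ResVar.measurableSet_output {V O : Type} (out : O → V) {B : Set (O → ℝ)}
    (hB : MeasurableSet B) :
    MeasurableSet {X : ResVar V → ℝ | (fun o => X (Sum.inl (out o))) ∈ B} :=
  (measurable_pi_lambda _ fun o => measurable_pi_apply (Sum.inl (out o))) hB

namespace Program

variable {V O Λ : Type} [DecidableEq Λ] (P : Program V O Λ)

/-- The cumulative weight is almost surely at most every bound for the weights of all runs. -/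
theorem ae_cumWeight_le [Fintype V] {M : ℝ} (hterm : ∀ᵐ ρ ∂P.pcfg.runMeasure, ρ ∈ P.pcfg.Reach)
    (hbound : P.pcfg.WeightBoundedBy M) :
    ∀ᵐ ρ ∂P.pcfg.runMeasure, (P.pcfg.cumWeight ρ : ℝ) ≤ M := by
  filter_upwards [P.pcfg.ae_mem_run, hterm] with ρ h1 h2
  exact hbound ρ ⟨h1, h2⟩

variable [Fintype V] (M : ℝ)

/-- The location of the restarted program that corresponds to a location of the original one. The
terminal location corresponds to the start of the restart block. -/
noncomputable def restartLoc : Option P.body.Loc → Option (P.restart M).body.Loc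
  | none => some (Sum.inr (Stmt.restartBlock (Λ := Λ) M P.valIn).entry)
  | some l => some (Sum.inl (P.body.trackLoc l))

/-- The probability that the restarted program outputs a value in `B` from a given location and
valuation. -/
noncomputable def restartHit (B : Set (O → ℝ)) (l : Option (P.restart M).body.Loc)
    (X : ResVar V → ℝ) : ℝ≥0∞ :=
  (P.restart M).pcfg.hit {X | (fun o => X (Sum.inl (P.out o))) ∈ B} (l, X)

variable {P M} {B : Set (O → ℝ)}

theorem measurable_restartHit (hB : MeasurableSet B) (l : Option (P.restart M).body.Loc) :
    Measurable (P.restartHit M B l) :=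
  (PCFG.measurable_hit (ResVar.measurableSet_output P.out hB)).comp
    (measurable_prodMk_left : Measurable fun X : ResVar V → ℝ =>
      ((l, X) : (P.restart M).pcfg.State))

theorem restartHit_le_one (l : Option (P.restart M).body.Loc) (X : ResVar V → ℝ) :
    P.restartHit M B l X ≤ 1 := PCFG.hit_le_one _

open Classical in
theorem restartHit_none (X : ResVar V → ℝ) :
    P.restartHit M B none X = if (fun o => X (Sum.inl (P.out o))) ∈ B then 1 else 0 :=
  PCFG.hit_of_eq rfl

theorem restartHit_some (hB : MeasurableSet B) (l : (P.restart M).body.Loc) (X : ResVar V → ℝ) :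
    P.restartHit M B (some l) X =
      ((P.restart M).node (some l)).expect (P.restartHit M B) X := by
  refine (PCFG.hit_of_ne (ResVar.measurableSet_output P.out hB) (Option.some_ne_none l)).trans ?_
  exact lintegral_stepKernel _ _ _ (PCFG.measurable_hit (ResVar.measurableSet_output P.out hB))

theorem restartLoc_find {a : Λ} (ha : a ∈ P.body.gotos) :
    P.restartLoc M (P.body.find a) = (P.restart M).body.find (some a) := by
  obtain ⟨l, hl⟩ := Stmt.exists_find_eq_some (P.gotos_subset a ha)
  have h1 : (Stmt.label none P.body.trackWeight).find (some a) = some (P.body.trackLoc l) := by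
    refine (if_neg (by simp)).trans ?_
    rw [Stmt.find_trackWeight, hl]
    rfl
  rw [hl]
  change _ = (Option.map Sum.inl ((Stmt.label none P.body.trackWeight).find (some a))).or _
  rw [h1]
  rfl

theorem restart_find_none :
    (P.restart M).body.find none = P.restartLoc M (some P.body.entry) := by
  have h1 : (Stmt.label none P.body.trackWeight).find none = some P.body.trackWeight.entry :=
    if_pos rfl
  change (Option.map Sum.inl ((Stmt.label none P.body.trackWeight).find none)).or _ = _
  rw [h1, restartLoc, Stmt.trackLoc_entry]
  rfl

/-- The simulation: before termination of the original program, one step of it preserves the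
probability that the restarted program outputs a value in `B`. -/
theorem restartHit_restartLoc_some (hB : MeasurableSet B) (l : P.body.Loc) (x : V → ℝ) (w : ℝ≥0)
    (c : ℝ) :
    P.restartHit M B (P.restartLoc M (some l)) (ResVar.mk x w c) =
      (P.node (some l)).expect (fun k y => P.restartHit M B (P.restartLoc M k)
        (ResVar.mk y ((w * (P.node (some l)).weight x : ℝ≥0) : ℝ) c)) x :=
  Stmt.eq_expect_of_trackWeight (measurable_restartHit hB) (σ := P.restartLoc M) P.body
    (tgt := fun a => P.body.find a) (tgt' := fun a => (P.restart M).body.find a)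
    (emb := some) (emb' := fun k => some (Sum.inl k)) (next := none) (fun _ => rfl)
    (fun _ ha => restartLoc_find ha) (fun k X => restartHit_some hB (Sum.inl k) X) l x w c

open Classical in
theorem restartHit_restartLoc_none (hB : MeasurableSet B) (x : V → ℝ) (w c : ℝ) :
    P.restartHit M B (P.restartLoc M none) (ResVar.mk x w c) =
      ∫⁻ r, (if r < 1 - w / M
        then P.restartHit M B (P.restartLoc M (some P.body.entry)) (ResVar.mk P.valIn 1 r)
        else if (fun o => x (P.out o)) ∈ B then 1 else 0) ∂(uniformUnit : Measure ℝ) := by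
  refine (Stmt.eq_of_restartBlock (measurable_restartHit hB)
    (tgt := fun a => (P.restart M).body.find a) (emb := fun k => some (Sum.inr k)) (next := none)
    (fun k X => restartHit_some hB (Sum.inr k) X) x w c).trans ?_
  simp only [restart_find_none, restartHit_none, ResVar.mk_inl]
  rfl

/-- By optional stopping, a round started with weight one gives the restart block the terminal
valuation and the cumulative weight of a random run of the original program. -/
theorem restartHit_start (hterm : ∀ᵐ ρ ∂P.pcfg.runMeasure, ρ ∈ P.pcfg.Reach)
    (hB : MeasurableSet B) (c : ℝ) :
    P.restartHit M B (P.restartLoc M (some P.body.entry)) (ResVar.mk P.valIn 1 c) =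
      ∫⁻ ρ, P.restartHit M B (P.restartLoc M none)
        (ResVar.mk (ρ (P.pcfg.termTime ρ)).2 (P.pcfg.cumWeight ρ) c) ∂P.pcfg.runMeasure := by
  have hmeas (l : Option P.body.Loc) : Measurable fun p : (V → ℝ) × ℝ≥0 =>
      P.restartHit M B (P.restartLoc M l) (ResVar.mk p.1 p.2 c) :=
    (measurable_restartHit hB _).comp (ResVar.measurable_mk.comp
      (f := fun p : (V → ℝ) × ℝ≥0 => (p.1, (p.2 : ℝ), c)) (by fun_prop))
  have hf : Measurable fun z : P.pcfg.State × ℝ≥0 =>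
      P.restartHit M B (P.restartLoc M z.1.1) (ResVar.mk z.1.2 z.2 c) := by
    have h : Measurable fun p : P.pcfg.Loc × ((V → ℝ) × ℝ≥0) =>
        P.restartHit M B (P.restartLoc M p.1) (ResVar.mk p.2.1 p.2.2 c) :=
      measurable_from_prod_countable_right hmeas
    exact h.comp (f := fun z : P.pcfg.State × ℝ≥0 => (z.1.1, (z.1.2, z.2))) (by fun_prop)
  have key := PCFG.lintegral_termTime hf (fun z => restartHit_le_one _ _) (fun s w hs => ?_) hterm
  · refine Eq.trans ?_ (key.symm.trans (lintegral_congr_ae ?_))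
    · rw [NNReal.coe_one]
      rfl
    · filter_upwards [hterm] with ρ hρ
      rw [PCFG.fst_termTime hρ]
      rfl
  · obtain ⟨l, x⟩ := s
    obtain ⟨l, rfl⟩ := Option.ne_none_iff_exists'.1 hs
    refine (restartHit_restartLoc_some hB l x w c).trans ?_
    exact (P.lintegral_stepKernel (some l) x
      (f := fun t => P.restartHit M B (P.restartLoc M t.1)
        (ResVar.mk t.2 ((w * (P.node (some l)).weight x : ℝ≥0) : ℝ) c))
      (hf.comp (measurable_prodMk_right (y := w * (P.node (some l)).weight x)))).symm

/-- The probability that the restarted program outputs a value in `B` is the normalized probability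
of `B` under the original one. -/
theorem restart_runMeasure_reachOutput (hM : 0 < M)
    (hterm : ∀ᵐ ρ ∂P.pcfg.runMeasure, ρ ∈ P.pcfg.Reach) (hint : P.pcfg.WeightIntegrable)
    (hbound : P.pcfg.WeightBoundedBy M) (hB : MeasurableSet B) :
    (P.restart M).pcfg.runMeasure ((P.restart M).pcfg.ReachOutput B) = P.pcfg.nod B := by
  classical
  set C := P.pcfg
  set μ := C.runMeasure
  set start := P.restartLoc M (some P.body.entry)
  set p := P.restartHit M B start (ResVar.mk P.valIn 1 0) with hp
  have hinit : (P.restart M).pcfg.runMeasure ((P.restart M).pcfg.ReachOutput B) = p := by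
    refine (PCFG.hit_init (C := (P.restart M).pcfg)
      (ResVar.measurableSet_output P.out hB)).symm.trans ?_
    change P.restartHit M B (some (Sum.inl P.body.trackWeight.entry)) (ResVar.mk P.valIn 1 0) = p
    rw [← Stmt.trackLoc_entry]
    rfl
  -- The restart block overwrites the coin, so that all rounds start alike.
  have hcoin (c : ℝ) : P.restartHit M B start (ResVar.mk P.valIn 1 c) = p := by
    rw [hp, restartHit_start hterm hB, restartHit_start hterm hB]
    simp only [restartHit_restartLoc_none hB]
  have hround : p = ∫⁻ ρ, (ENNReal.ofReal (1 - C.cumWeight ρ / M) * p +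
      (C.ReachOutput B).indicator (fun ρ => ENNReal.ofReal (C.cumWeight ρ / M)) ρ) ∂μ := by
    refine (restartHit_start hterm hB 0).trans (lintegral_congr_ae ?_)
    filter_upwards [hterm, P.ae_cumWeight_le hterm hbound] with ρ hρ hle
    have hle' : (C.cumWeight ρ : ℝ) / M ≤ 1 := (div_le_one hM).2 hle
    have h0 : 0 ≤ (C.cumWeight ρ : ℝ) / M := by positivity
    rw [restartHit_restartLoc_none hB]
    simp only [start] at hcoin
    simp only [hcoin]
    rw [lintegral_uniformUnit_ite (by linarith) (by linarith), sub_sub_cancel]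
    congr 1
    rw [Set.indicator_apply, mul_ite, mul_one, mul_zero]
    exact if_congr (and_iff_right hρ).symm rfl rfl
  -- The expectation of `hround`, with the probability `q` that a round restarts.
  set m := ENNReal.ofReal M
  have hm0 : m ≠ 0 := (ENNReal.ofReal_pos.2 hM).ne'
  have hmt : m ≠ ∞ := ENNReal.ofReal_ne_top
  have hdiv (ρ) : ENNReal.ofReal (C.cumWeight ρ / M) = C.cumWeight ρ * m⁻¹ := by
    rw [ENNReal.ofReal_div_of_pos hM, ENNReal.ofReal_coe_nnreal, div_eq_mul_inv]
  have hW : Measurable fun ρ => (C.cumWeight ρ : ℝ≥0∞) := C.measurable_cumWeight.coe_nnreal_ennreal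
  have hW' : Measurable fun ρ => ENNReal.ofReal (1 - C.cumWeight ρ / M) :=
    (measurable_const.sub (C.measurable_cumWeight.coe_nnreal_real.div_const M)).ennreal_ofReal
  set q := ∫⁻ ρ, ENNReal.ofReal (1 - C.cumWeight ρ / M) ∂μ with hq
  set b := ∫⁻ ρ in C.ReachOutput B, (C.cumWeight ρ : ℝ≥0∞) ∂μ with hb
  have hround' : p = q * p + b * m⁻¹ := by
    conv_lhs => rw [hround]
    rw [lintegral_add_left (hW'.mul_const p), lintegral_mul_const _ hW',
      lintegral_indicator (C.measurableSet_reachOutput hB)]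
    simp only [hdiv]
    rw [lintegral_mul_const _ hW]
  have ha : C.expWeight = ∫⁻ ρ, (C.cumWeight ρ : ℝ≥0∞) ∂μ := by
    have huniv : C.Reach =ᵐ[μ] Set.univ := Filter.eventuallyEq_univ.2 hterm
    rw [PCFG.expWeight_eq, setLIntegral_congr huniv, setLIntegral_univ]
  have hone : q + C.expWeight * m⁻¹ = 1 := by
    rw [ha, hq, ← lintegral_mul_const _ hW, ← lintegral_add_left hW',
      lintegral_congr_ae (g := fun _ => 1), lintegral_one, measure_univ]
    filter_upwards [P.ae_cumWeight_le hterm hbound] with ρ hle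
    have hle' : (C.cumWeight ρ : ℝ) / M ≤ 1 := (div_le_one hM).2 hle
    have h0 : 0 ≤ (C.cumWeight ρ : ℝ) / M := by positivity
    rw [← hdiv, ← ENNReal.ofReal_add (by linarith) h0, sub_add_cancel, ENNReal.ofReal_one]
  have hp1 : p ≤ 1 := restartHit_le_one _ _
  have hq1 : q ≤ 1 := hone ▸ le_self_add
  have hqp : q * p ≠ ∞ :=
    ENNReal.mul_ne_top (hq1.trans_lt ENNReal.one_lt_top).ne (hp1.trans_lt ENNReal.one_lt_top).ne
  -- Of the two forms `p * (q + a / M)` and `q * p + b / M` of `p`, cancel the rounds that restart.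
  have heq : q * p + C.expWeight * m⁻¹ * p = q * p + b * m⁻¹ := by
    rw [← add_mul, hone, one_mul]; exact hround'
  have heq' : p * C.expWeight = b := by
    have h := (ENNReal.add_right_inj hqp).1 heq
    have h' : C.expWeight * m⁻¹ * p * m = b * m⁻¹ * m := by rw [h]
    rw [mul_assoc b, ENNReal.inv_mul_cancel hm0 hmt, mul_one] at h'
    rw [← h', mul_right_comm, mul_assoc C.expWeight, ENNReal.inv_mul_cancel hm0 hmt, mul_one,
      mul_comm]
  rw [hinit, PCFG.nod_eq, ← hb, ← heq', ENNReal.mul_div_cancel_right hint.1.ne' hint.2.ne]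

end Program

theorem theorem1 {V O Λ : Type} [Fintype V] [DecidableEq Λ] (P : Program V O Λ) (M : ℝ)
    (hM : 0 < M) (hterm : P.pcfg.ASTerminating) (hint : P.pcfg.WeightIntegrable)
    (hbound : P.pcfg.WeightBoundedBy M) :
    (P.restart M).ConditioningFree ∧
      (P.restart M).pcfg.ASTerminating ∧
      (P.restart M).pcfg.WeightIntegrable ∧
      (P.restart M).pcfg.WeightBounded ∧
      PCFG.OutputEquivalent P.pcfg (P.restart M).pcfg := by
  have hfree := P.conditioningFree_restart M
  have hreach := P.pcfg.asTerminating_iff.1 hterm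
  have hprob {B : Set (O → ℝ)} (hB : MeasurableSet B) :=
    Program.restart_runMeasure_reachOutput hM hreach hint hbound hB
  have hone : (P.restart M).pcfg.runMeasure (P.restart M).pcfg.Reach = 1 := by
    have huniv : P.pcfg.nod Set.univ = 1 := by
      have h : P.pcfg.ReachOutput Set.univ = P.pcfg.Reach := Set.inter_univ _
      rw [PCFG.nod_eq, h, ← PCFG.expWeight_eq]
      exact ENNReal.div_self hint.1.ne' hint.2.ne
    have h : (P.restart M).pcfg.ReachOutput Set.univ = (P.restart M).pcfg.Reach :=
      Set.inter_univ _
    rw [← h, hprob MeasurableSet.univ, huniv]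
  have hexp : (P.restart M).pcfg.expWeight = 1 := by
    rw [PCFG.expWeight_eq]
    simp only [hfree.cumWeight_eq_one, ENNReal.coe_one, setLIntegral_one, hone]
  refine ⟨hfree, ?_, ?_, ⟨1, one_pos, fun ρ _ => ?_⟩, fun B hB => ?_⟩
  · rw [PCFG.ASTerminating, measure_congr (P.restart M).pcfg.term_ae_eq, hone]
  · rw [PCFG.WeightIntegrable, hexp]
    exact ⟨one_pos, ENNReal.one_lt_top⟩
  · rw [hfree.cumWeight_eq_one, NNReal.coe_one]
  · rw [PCFG.nod_eq (P.restart M).pcfg, hexp, div_one]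
    simp only [hfree.cumWeight_eq_one, ENNReal.coe_one, setLIntegral_one]
    exact (hprob hB).symm
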